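/- Let $a<b$ be real, $\alpha>0$, $\theta\in[0,1]$ and $\beta\in(1,2]$. For $\sigma>0$ and $n=\lceil\sigma\rceil$, and $-\infty\le a'<b'\le+\infty$, let $${}_{a'}D_x^{\sigma}v(x)=\frac{d^n}{dx^n}\,\frac{1}{\Gamma(n-\sigma)}\int_{a'}^{x}\frac{v(\zeta)}{(x-\zeta)^{1-n+\sigma}}\,d\zeta,\qquad {}_xD_{b'}^{\sigma}v(x)=(-1)^n\frac{d^n}{dx^n}\,\frac{1}{\Gamma(n-\sigma)}\int_{x}^{b'}\frac{v(\zeta)}{(\zeta-x)^{1-n+\sigma}}\,d\zeta$$ be the left and right Riemann--Liouville derivatives if $n-1<\sigma<n$, and let them be $v^{(n)}$ and $(-1)^nv^{(n)}$ if $\sigma=n$. Consider the boundary value problem $$\alpha u-\theta\,{}_aD_x^{\beta}u-(1-\theta)\,{}_xD_b^{\beta}u=f\ \text{ in }(a,b),\qquad u(a)=u(b)=0. \tag{1}$$ For an integer $M\ge1$ put $h=(b-a)/M$ and $x_j=a+jh$. Let $g_k=(-1)^k\binom{\beta}{k}$, $\lambda_1=\frac{\beta^2+3\beta+2}{12}$,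 $\lambda_0=\frac{4-\beta^2}{6}$, $\lambda_{-1}=\frac{\beta^2-3\beta+2}{12}$ and $w_k=\lambda_1g_k+\lambda_0g_{k-1}+\lambda_{-1}g_{k-2}$ for $k\ge0$, where $g_{-1}=g_{-2}=0$. The weighted shifted Grünwald difference (WSGD) scheme for $u_0,\dots,u_M$ is $$\alpha u_j-\frac{\theta}{h^{\beta}}\sum_{k=0}^{j}w_ku_{j-k+1}-\frac{1-\theta}{h^{\beta}}\sum_{k=0}^{M-j}w_ku_{j+k-1}=f(x_j)\quad(1\le j\le M-1),\qquad u_0=u_M=0. \tag{2}$$ **Theorem.** (i) For every $M\ge1$ and every right-hand side $f$ the scheme (2) has exactly one solution. (ii) Let $u$, continuous on $[a,b]$, solve (1) pointwise, and let $\widetilde u$ be its extension by $0$ to $\mathbb{R}$. Suppose that $\widetilde u\in L^1(\mathbb{R})$, that ${}_{-\infty}D_x^{\beta+2}\widetilde u$ and ${}_xD_{+\infty}^{\beta+2}\widetilde u$ exist everywhere on $\mathbb{R}$, and that these two functions and their Fourier transforms belong to $L^1(\mathbb{R})$. Then there is a constant $c$, independent of $M$ (that is, of $h$), such that for every $M\ge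 1$ the solution of (2) satisfies $$|u(x_j)-u_j|\le c\,h^2\qquad(1\le j\le M-1).$$ -/

import Mathlib

open MeasureTheory Set
open scoped FourierTransform

noncomputable section

namespace WSGD

/-- The left-sided Riemann-Liouville integral of order `μ ∈ (0,1)` of `v`, with lower limit `a`
(a real number or `-∞ = ⊥`), at the point `x`; the integral of order `0` is `v` itself. -/
def leftRLIntegral (a : EReal) (μ : ℝ) (v : ℝ → ℝ) (x : ℝ) : ℝ :=
  if μ = 0 then v x
  else 1 / Real.Gamma μ * ∫ ζ in {ζ : ℝ | a < (ζ : EReal) ∧ ζ < x}, v ζ / (x - ζ) ^ (1 - μ)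

/-- The right-sided Riemann-Liouville integral of order `μ ∈ (0,1)` of `v`, with upper limit `b`
(a real number or `+∞ = ⊤`), at the point `x`; the integral of order `0` is `v` itself. -/
def rightRLIntegral (b : EReal) (μ : ℝ) (v : ℝ → ℝ) (x : ℝ) : ℝ :=
  if μ = 0 then v x
  else 1 / Real.Gamma μ * ∫ ζ in {ζ : ℝ | x < ζ ∧ (ζ : EReal) < b}, v ζ / (ζ - x) ^ (1 - μ)

/-- The left-sided Riemann-Liouville derivative of order `σ > 0`, where `n = ⌈σ⌉`
(so `n - 1 < σ ≤ n`): the `n`-th derivative of the integral of order `n - σ`. -/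
def leftRLDeriv (a : EReal) (σ : ℝ) (v : ℝ → ℝ) (x : ℝ) : ℝ :=
  iteratedDeriv ⌈σ⌉₊ (leftRLIntegral a ((⌈σ⌉₊ : ℝ) - σ) v) x

/-- The right-sided Riemann-Liouville derivative of order `σ > 0`, where `n = ⌈σ⌉`. -/
def rightRLDeriv (b : EReal) (σ : ℝ) (v : ℝ → ℝ) (x : ℝ) : ℝ :=
  (-1) ^ ⌈σ⌉₊ * iteratedDeriv ⌈σ⌉₊ (rightRLIntegral b ((⌈σ⌉₊ : ℝ) - σ) v) x

/-- The `n`-th derivative in `leftRLDeriv a σ v` exists (it is not a default value) at every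
point of the open set `S`. -/
def LeftRLDifferentiableOn (a : EReal) (σ : ℝ) (v : ℝ → ℝ) (S : Set ℝ) : Prop :=
  ∀ m < ⌈σ⌉₊, ∀ x ∈ S,
    DifferentiableAt ℝ (iteratedDeriv m (leftRLIntegral a ((⌈σ⌉₊ : ℝ) - σ) v)) x

/-- The `n`-th derivative in `rightRLDeriv b σ v` exists (it is not a default value) at every
point of the open set `S`. -/
def RightRLDifferentiableOn (b : EReal) (σ : ℝ) (v : ℝ → ℝ) (S : Set ℝ) : Prop :=
  ∀ m < ⌈σ⌉₊, ∀ x ∈ S,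
    DifferentiableAt ℝ (iteratedDeriv m (rightRLIntegral b ((⌈σ⌉₊ : ℝ) - σ) v)) x

/-- `u` is a (continuous, pointwise) solution on `[a,b]` of
`α u - θ ₐD_x^β u - (1-θ) ₓD_b^β u = f` in `(a,b)`, `u(a) = u(b) = 0`. -/
structure IsBVPSolution (a b α β θ : ℝ) (f u : ℝ → ℝ) : Prop where
  continuousOn : ContinuousOn u (Icc a b)
  left_differentiable : LeftRLDifferentiableOn (a : EReal) β u (Ioo a b)
  right_differentiable : RightRLDifferentiableOn (b : EReal) β u (Ioo a b)
  equation : ∀ x ∈ Ioo a b,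
    α * u x - θ * leftRLDeriv (a : EReal) β u x - (1 - θ) * rightRLDeriv (b : EReal) β u x = f x
  left_boundary : u a = 0
  right_boundary : u b = 0

/-- The coefficients `g_k = (-1)^k binom(β, k)` of the power series of `(1-z)^β`. -/
def g (β : ℝ) (k : ℕ) : ℝ := (-1) ^ k * Ring.choose β k

/-- The weights of the weighted shifted Grünwald difference: `w_k = λ₁ g_k + λ₀ g_{k-1} +
λ₋₁ g_{k-2}`, where coefficients `g` of negative index are omitted. -/
def w (β : ℝ) : ℕ → ℝ
  | 0 => (β ^ 2 + 3 * β + 2) / 12 * g β 0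
  | 1 => (β ^ 2 + 3 * β + 2) / 12 * g β 1 + (4 - β ^ 2) / 6 * g β 0
  | k + 2 => (β ^ 2 + 3 * β + 2) / 12 * g β (k + 2) + (4 - β ^ 2) / 6 * g β (k + 1)
      + (β ^ 2 - 3 * β + 2) / 12 * g β k

/-- The mesh size `h = (b-a)/M`. -/
def step (a b : ℝ) (M : ℕ) : ℝ := (b - a) / M

/-- The grid points `x_j = a + j h`. -/
def node (a b : ℝ) (M j : ℕ) : ℝ := a + j * step a b M

/-- The left difference operator at the index `j`, `1 ≤ j ≤ M - 1`, with step `h`. A grid function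
is given by a sequence `v`, of which only `v_0, …, v_M` are used. -/
def deltaLeft (β h : ℝ) (v : ℕ → ℝ) (j : ℕ) : ℝ :=
  1 / h ^ β * ∑ k ∈ Finset.range (j + 1), w β k * v (j + 1 - k)

/-- The right difference operator at the index `j`, `1 ≤ j ≤ M - 1`, with step `h`. -/
def deltaRight (β h : ℝ) (M : ℕ) (v : ℕ → ℝ) (j : ℕ) : ℝ :=
  1 / h ^ β * ∑ k ∈ Finset.range (M - j + 1), w β k * v (j + k - 1)

/-- `U_0, …, U_M` solves the weighted shifted Grünwald difference scheme on the mesh with `M`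
cells. -/
structure IsSchemeSolution (a b α β θ : ℝ) (f : ℝ → ℝ) (M : ℕ) (U : ℕ → ℝ) : Prop where
  equation : ∀ j : ℕ, 1 ≤ j → j < M →
    α * U j - θ * deltaLeft β (step a b M) U j - (1 - θ) * deltaRight β (step a b M) M U j
      = f (node a b M j)
  left_boundary : U 0 = 0
  right_boundary : U M = 0

end WSGD

end

noncomputable section

/-! ### Signs, decay and partial sums of the weights -/

namespace WSGD

/-! The scheme is stable in the maximum norm, uniformly in the mesh, and consistent of order two.
Convergence follows from the two together, and unique solvability is stability with zero right-hand
side.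

Stability. The left and right difference matrices are transposes of each other, so they have the
same quadratic form and `θ` drops out of the energy. After symmetrisation the off-diagonal entries
are nonnegative (`offDiag_nonneg`) and the partial sums of the weights are nonpositive
(`sum_w_nonpos`). Hence minus the form dominates a weighted sum of squares `(e_{i+m} - e_i)²`, with
weights at least a multiple of `m^(-1-β)` if `β < 2`: a discrete Slobodeckij seminorm of order
`β/2`. Since `β/2 > 1/2`, it controls the maximum (`sq_le_neg_toeplitzForm`). Testing the error
equation with the error itself, the powers of `M` and `h` combine to `(b-a)^β` (`scheme_stability`).

Consistency. Under the Laplace transform the difference quotient becomes multiplication by `h^(-β)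
W(sh)`, where `W` is `symbol β` and `W(z) = z^β (1 + O(z²))`: the three `λ` cancel the first-order
term. Expressed through the transform of the derivative of order `β+2`, the truncation error has the
multiplier `s^(-β-2) h^(-β) (W(sh) - (sh)^β) = O(h²)`. The argument runs on a line `Re s = ε > 0`,
where the series converge and the powers of `s` are regular; the one-sided support of the function
makes the weight `e^(-εx)` harmless. Letting `ε → 0` bounds the error by `h²` times the `L¹` norm of
the Fourier transform (`DerivChain.exists_truncation_le`). The right operator is the left one after
reflection. -/

lemma g_zero (β : ℝ) : g β 0 = 1 := by simp [g]

lemma g_succ (β : ℝ) (k : ℕ) : g β (k + 1) = g β k * ((k - β) / (k + 1)) := by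
  have h : Ring.choose β (k + 1) = Ring.choose β k * ((β - k) / (k + 1)) := by
    rw [Ring.choose_eq_smul, Ring.choose_eq_smul, descPochhammer_succ_right,
      Polynomial.smeval_mul, Nat.factorial_succ]
    simp only [Polynomial.smeval_sub, Polynomial.smeval_X, Polynomial.smeval_natCast, pow_one,
      pow_zero, smul_eq_mul, nsmul_eq_mul, mul_one]
    push_cast
    have := Nat.factorial_ne_zero k
    field_simp
  simp only [g, h, pow_succ]
  ring

lemma g_one (β : ℝ) : g β 1 = -β := by
  have := g_succ β 0
  simpa [g_zero] using this

lemma g_two (β : ℝ) : g β 2 = β * (β - 1) / 2 := by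
  rw [g_succ β 1, g_one]; push_cast; ring

lemma g_three (β : ℝ) : g β 3 = β * (β - 1) * (2 - β) / 6 := by
  rw [g_succ β 2, g_two]; push_cast; ring

lemma g_add_two_nonneg {β : ℝ} (hβ : 1 < β) (hβ' : β ≤ 2) (k : ℕ) : 0 ≤ g β (k + 2) := by
  induction k with
  | zero => rw [g_two]; have : 0 ≤ β - 1 := by linarith
            positivity
  | succ k ih =>
    rw [g_succ β (k + 2)]
    refine mul_nonneg ih (div_nonneg ?_ (by positivity))
    push_cast
    have : (0 : ℝ) ≤ k := by positivity
    linarith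

/-- The product on the right is nondecreasing in `k`. With `x = k + 2 - β` the ratio of consecutive
`g` is `x / (x + β + 1)`, and Bernoulli's inequality gives `(1 + 1/x)^(β+1) ≥ (x + β + 1)/x`. This
is the decay `g_k ≳ k^(-1-β)`. -/
lemma g_add_two_lower_bound {β : ℝ} (hβ : 1 < β) (hβ' : β < 2) (k : ℕ) :
    g β 2 * (2 - β) ^ (β + 1) ≤ g β (k + 2) * (k + 2 - β) ^ (β + 1) := by
  induction k with
  | zero => simp
  | succ k ih =>
    refine ih.trans ?_
    have hk : (0 : ℝ) ≤ k := by positivity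
    have hpos : 0 < (k : ℝ) + 2 - β := by linarith
    rw [g_succ β (k + 2), mul_assoc]
    refine mul_le_mul_of_nonneg_left ?_ (g_add_two_nonneg hβ hβ'.le k)
    push_cast
    have h1 : 1 + (β + 1) * (1 / (k + 2 - β)) ≤ (1 + 1 / (k + 2 - β)) ^ (β + 1) :=
      one_add_mul_self_le_rpow_one_add (by have := (one_div_pos.2 hpos).le; linarith) (by linarith)
    have h2 : ((k : ℝ) + 1 + 2 - β) ^ (β + 1)
        = (k + 2 - β) ^ (β + 1) * (1 + 1 / (k + 2 - β)) ^ (β + 1) := by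
      rw [← Real.mul_rpow hpos.le (by positivity)]
      congr 1; field_simp; ring
    rw [h2]
    have h3 : ((k : ℝ) + 2 - β) / (k + 2 + 1) * (1 + (β + 1) * (1 / (k + 2 - β))) = 1 := by
      field_simp; ring
    have h4 : 0 ≤ ((k : ℝ) + 2 - β) / (k + 2 + 1) := by positivity
    calc ((k : ℝ) + 2 - β) ^ (β + 1)
        = (k + 2 - β) ^ (β + 1) * (((k : ℝ) + 2 - β) / (k + 2 + 1)
            * (1 + (β + 1) * (1 / (k + 2 - β)))) := by rw [h3, mul_one]
      _ ≤ (k + 2 - β) ^ (β + 1) * (((k : ℝ) + 2 - β) / (k + 2 + 1)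
            * (1 + 1 / (k + 2 - β)) ^ (β + 1)) := by gcongr
      _ = _ := by ring

lemma w_add_two (β : ℝ) (k : ℕ) : w β (k + 2) = (β ^ 2 + 3 * β + 2) / 12 * g β (k + 2)
    + (4 - β ^ 2) / 6 * g β (k + 1) + (β ^ 2 - 3 * β + 2) / 12 * g β k := rfl

lemma w_add_four (β : ℝ) (k : ℕ) : w β (k + 4) = g β (k + 2) / (12 * (k + 3) * (k + 4)) *
    (12 * (k + 4) ^ 2 - 6 * (β ^ 2 + 3 * β + 4) * (k + 4) + (β ^ 2 + 3 * β + 2) ^ 2) := by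
  rw [w_add_two β (k + 2), g_succ β (k + 2 + 1), g_succ β (k + 2)]
  push_cast
  field_simp
  ring

/-- The off-diagonal entries of the symmetric part of the Toeplitz matrix with symbol `w`. -/
def offDiag (β : ℝ) : ℕ → ℝ
  | 0 => 0
  | 1 => w β 0 + w β 2
  | m + 2 => w β (m + 3)

/-- The weight `w β 2` alone can be negative; only its sum with `w β 0` has a sign, which is why the
form is symmetrised. -/
lemma offDiag_one_pos {β : ℝ} (hβ : 1 < β) : 0 < offDiag β 1 := by
  have : offDiag β 1 = (β - 1) * (β ^ 3 + 7 * β ^ 2 + 10 * β - 8) / 24 := by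
    simp only [offDiag, w, zero_add, g_zero, g_one, g_two]
    ring
  rw [this]
  have h1 : 0 < β - 1 := by linarith
  have h2 : 0 < β ^ 3 + 7 * β ^ 2 + 10 * β - 8 := by
    have : 0 < β ^ 3 := by positivity
    nlinarith
  positivity

lemma offDiag_two (β : ℝ) : offDiag β 2 = β * (β - 1) * (2 - β) *
    ((β ^ 2 + 3 * β + 2) / 72 + (2 + β) / 12 + 1 / 12) := by
  simp only [offDiag, w, Nat.reduceAdd, g_one, g_two, g_three]
  ring

/-- Expanding about `k = 0` exhibits the quadratic factor of `w_add_four` as a sum of nonnegative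
terms. Here `s = β² + 3β + 2`, so `12 - s` is positive exactly when `β < 2` in the range considered.
The constant 50 is not sharp. -/
lemma quadratic_lower_bound {s k : ℝ} (hs : 6 ≤ s) (hs' : s ≤ 12) (hk : 0 ≤ k) :
    (12 - s) ^ 2 / 50 * ((k + 3) * (k + 4)) ≤ 12 * (k + 4) ^ 2 - 6 * (s + 2) * (k + 4) + s ^ 2 := by
  have h : 12 * (k + 4) ^ 2 - 6 * (s + 2) * (k + 4) + s ^ 2
      = 12 * (k * (k + 1)) + (12 - s) * (6 * k) + (12 - s) ^ 2 := by ring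
  rw [h]
  have h2 : (12 - s) ^ 2 ≤ 36 := by nlinarith
  have h3 : 0 ≤ (12 - s) * (6 * k) := mul_nonneg (by linarith) (by linarith)
  have h4 : (12 - s) ^ 2 * k ^ 2 ≤ 36 * k ^ 2 := by gcongr
  have h5 : (12 - s) ^ 2 * k ≤ 36 * k := by gcongr
  nlinarith [sq_nonneg (12 - s)]

lemma offDiag_nonneg {β : ℝ} (hβ : 1 < β) (hβ' : β ≤ 2) (m : ℕ) : 0 ≤ offDiag β m := by
  match m with
  | 0 => exact le_rfl
  | 1 => exact (offDiag_one_pos hβ).le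
  | 2 =>
    rw [offDiag_two]
    have : 0 ≤ β - 1 := by linarith
    have : 0 ≤ 2 - β := by linarith
    positivity
  | k + 3 =>
    change 0 ≤ w β (k + 4)
    rw [w_add_four]
    have h := quadratic_lower_bound (s := β ^ 2 + 3 * β + 2) (k := k) (by nlinarith) (by nlinarith)
      (by positivity)
    refine mul_nonneg (div_nonneg (g_add_two_nonneg hβ hβ' k) (by positivity)) ?_
    have : 0 ≤ (12 - (β ^ 2 + 3 * β + 2)) ^ 2 / 50 * (((k : ℝ) + 3) * (k + 4)) := by positivity
    linarith

lemma exists_le_offDiag {β : ℝ} (hβ : 1 < β) (hβ' : β < 2) :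
    ∃ κ > 0, ∀ m : ℕ, 1 ≤ m → κ / (m : ℝ) ^ (1 + β) ≤ offDiag β m := by
  have hg2 : 0 < g β 2 := by
    rw [g_two]; have : 0 < β - 1 := by linarith
    positivity
  have h2 : 0 < 2 - β := by linarith
  have hs : β ^ 2 + 3 * β + 2 < 12 := by nlinarith
  set δ := (12 - (β ^ 2 + 3 * β + 2)) ^ 2 / 50 with hδ
  have hδpos : 0 < δ := by
    have : 0 < 12 - (β ^ 2 + 3 * β + 2) := by linarith
    positivity
  set κ₃ := g β 2 * (2 - β) ^ (β + 1) * δ / 12 with hκ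
  have hκ₃ : 0 < κ₃ := by positivity
  have hd1 := offDiag_one_pos hβ
  have hd2 : 0 < offDiag β 2 := by
    rw [offDiag_two]
    have : 0 < β - 1 := by linarith
    positivity
  refine ⟨min κ₃ (min (offDiag β 1) (offDiag β 2)), by positivity, fun m hm => ?_⟩
  match m, hm with
  | 1, _ => simp
  | 2, _ =>
    rw [div_le_iff₀ (by positivity)]
    have h1 : (1 : ℝ) ≤ ((2 : ℕ) : ℝ) ^ (1 + β) :=
      Real.one_le_rpow (by norm_num) (by linarith)
    have : min κ₃ (min (offDiag β 1) (offDiag β 2)) ≤ offDiag β 2 := by simp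
    nlinarith
  | k + 3, _ =>
    change _ ≤ w β (k + 4)
    have hk : (0 : ℝ) ≤ k := by positivity
    have hq := quadratic_lower_bound (s := β ^ 2 + 3 * β + 2) (k := k) (by nlinarith) (by nlinarith) hk
    have hg := g_add_two_lower_bound hβ hβ' k
    have hpow : ((k : ℝ) + 2 - β) ^ (β + 1) ≤ ((k : ℝ) + 3) ^ (β + 1) :=
      Real.rpow_le_rpow (by linarith) (by linarith) (by linarith)
    have hgn := g_add_two_nonneg hβ hβ'.le k
    have hg' : g β 2 * (2 - β) ^ (β + 1) / ((k : ℝ) + 3) ^ (β + 1) ≤ g β (k + 2) := by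
      rw [div_le_iff₀ (by positivity)]
      exact hg.trans (by gcongr)
    rw [w_add_four]
    calc min κ₃ (min (offDiag β 1) (offDiag β 2)) / ((k + 3 : ℕ) : ℝ) ^ (1 + β)
        ≤ κ₃ / ((k + 3 : ℕ) : ℝ) ^ (1 + β) := by gcongr; exact min_le_left _ _
      _ = g β 2 * (2 - β) ^ (β + 1) / ((k : ℝ) + 3) ^ (β + 1) / (12 * (k + 3) * (k + 4))
            * (δ * ((k + 3) * (k + 4))) := by
          push_cast
          rw [hκ, add_comm 1 β]
          field_simp
      _ ≤ g β (k + 2) / (12 * (k + 3) * (k + 4)) * (δ * ((k + 3) * (k + 4))) := by gcongr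
      _ ≤ _ := by
          refine mul_le_mul_of_nonneg_left ?_ (by positivity)
          rw [hδ]
          linarith

/-- In generating functions this is `(1-z)^β / (1-z) = (1-z)^(β-1)`. -/
lemma sum_g (β : ℝ) (n : ℕ) : ∑ k ∈ Finset.range (n + 1), g β k = g (β - 1) n := by
  induction n with
  | zero => simp [g_zero]
  | succ n ih =>
    -- Coefficient form of the derivative of `(1-z)^β`.
    have key : ∀ n : ℕ, (n + 1 : ℝ) * g β (n + 1) = -β * g (β - 1) n := by
      intro n
      induction n with
      | zero => simp [g_zero, g_one]
      | succ n ih =>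
        rw [g_succ β (n + 1), g_succ (β - 1) n]
        push_cast
        have h1 : (n + 1 : ℝ) ≠ 0 := by positivity
        have h2 : (n + 1 + 1 : ℝ) ≠ 0 := by positivity
        field_simp at ih ⊢
        linear_combination (n + 1 - β) * ih
    rw [Finset.sum_range_succ, ih, g_succ (β - 1) n]
    have h1 : (n + 1 : ℝ) ≠ 0 := by positivity
    have := key n
    field_simp
    linear_combination this

lemma g_sub_one_nonpos {β : ℝ} (hβ : 1 < β) (hβ' : β ≤ 2) (n : ℕ) : g (β - 1) (n + 1) ≤ 0 := by
  induction n with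
  | zero => rw [zero_add, g_one]; linarith
  | succ n ih =>
    rw [g_succ]
    refine mul_nonpos_of_nonpos_of_nonneg ih (div_nonneg ?_ (by positivity))
    push_cast
    have : (0 : ℝ) ≤ n := by positivity
    linarith

/-- From index 2 on the coefficients are nonnegative, and the total partial sums `g (β - 1) (n + 1)`
are nonpositive; so the tail sums are at most `β - 1`, the negative of the first two terms. -/
lemma summable_abs_g {β : ℝ} (hβ : 1 < β) (hβ' : β ≤ 2) : Summable fun k => |g β k| := by
  rw [← summable_nat_add_iff 2]
  simp_rw [abs_of_nonneg (g_add_two_nonneg hβ hβ' _)]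
  refine summable_of_sum_range_le (c := β - 1) (g_add_two_nonneg hβ hβ') fun n => ?_
  have h := sum_g β (n + 1)
  rw [Finset.sum_range_succ', Finset.sum_range_succ', g_zero, zero_add, g_one] at h
  have := g_sub_one_nonpos hβ hβ' n
  linarith

lemma summable_abs_w {β : ℝ} (hβ : 1 < β) (hβ' : β ≤ 2) : Summable fun k => |w β k| := by
  have h := summable_abs_g hβ hβ'
  rw [← summable_nat_add_iff 2]
  refine Summable.of_nonneg_of_le (fun _ => abs_nonneg _) (fun k => ?_)
    (((((summable_nat_add_iff 2).2 h).mul_left |(β ^ 2 + 3 * β + 2) / 12|).add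
      (((summable_nat_add_iff 1).2 h).mul_left |(4 - β ^ 2) / 6|)).add
      (h.mul_left |(β ^ 2 - 3 * β + 2) / 12|))
  rw [w_add_two]
  refine (abs_add_le _ _).trans (add_le_add ((abs_add_le _ _).trans (add_le_add ?_ ?_)) ?_) <;>
  rw [abs_mul]

lemma sum_w (β : ℝ) (n : ℕ) : ∑ k ∈ Finset.range (n + 3), w β k =
    (β ^ 2 + 3 * β + 2) / 12 * g (β - 1) (n + 2) + (4 - β ^ 2) / 6 * g (β - 1) (n + 1)
      + (β ^ 2 - 3 * β + 2) / 12 * g (β - 1) n := by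
  have h2 := sum_g β (n + 2)
  have h1 := sum_g β (n + 1)
  have h0 := sum_g β n
  rw [Finset.sum_range_succ', Finset.sum_range_succ'] at h2 ⊢
  rw [Finset.sum_range_succ'] at h1
  simp_rw [w_add_two, Finset.sum_add_distrib, ← Finset.mul_sum]
  rw [h0, eq_sub_of_add_eq h1, eq_sub_of_add_eq (eq_sub_of_add_eq h2)]
  simp only [w]
  ring

lemma sum_w_nonpos {β : ℝ} (hβ : 1 < β) (hβ' : β ≤ 2) (n : ℕ) :
    ∑ k ∈ Finset.range (n + 4), w β k ≤ 0 := by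
  rw [sum_w β (n + 1), g_succ _ (n + 1 + 1), g_succ _ (n + 1)]
  have h := g_sub_one_nonpos hβ hβ' n
  have hn : (0 : ℝ) ≤ n := by positivity
  have key : 0 ≤ 12 * ((n : ℝ) + 3) ^ 2 - 6 * (β * (β + 2) + 2) * (n + 3)
      + β * (β + 2) * (β * (β + 2) + 1) := by
    have : 12 * ((n : ℝ) + 3) ^ 2 - 6 * (β * (β + 2) + 2) * (n + 3)
      + β * (β + 2) * (β * (β + 2) + 1) = 12 * (n * (n + 1))
        + (8 - β * (β + 2)) * (6 * n + 9 - β * (β + 2)) := by ring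
    rw [this]
    have h8 : 0 ≤ 8 - β * (β + 2) := by nlinarith
    have : 0 ≤ 6 * n + 9 - β * (β + 2) := by linarith
    positivity
  have : (β ^ 2 + 3 * β + 2) / 12 * (g (β - 1) (n + 1) * (((n + 1 : ℕ) - (β - 1)) /
      ((n + 1 : ℕ) + 1)) * (((n + 1 + 1 : ℕ) - (β - 1)) / ((n + 1 + 1 : ℕ) + 1))) +
      (4 - β ^ 2) / 6 * (g (β - 1) (n + 1) * (((n + 1 : ℕ) - (β - 1)) / ((n + 1 : ℕ) + 1))) +
      (β ^ 2 - 3 * β + 2) / 12 * g (β - 1) (n + 1)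
      = g (β - 1) (n + 1) * ((12 * ((n : ℝ) + 3) ^ 2 - 6 * (β * (β + 2) + 2) * (n + 3)
      + β * (β + 2) * (β * (β + 2) + 1)) / (12 * (n + 2) * (n + 3))) := by
    push_cast
    field_simp
    ring
  rw [this]
  exact mul_nonpos_of_nonpos_of_nonneg h (by positivity)

end WSGD

/-! ### The Toeplitz quadratic form and its coercivity -/

namespace WSGD

/-- The autocorrelation `∑ e_i e_{i+m}` of a sequence supported in `{0, …, M - 1}`. -/
def autocorr (e : ℕ → ℝ) (M m : ℕ) : ℝ := ∑ i ∈ Finset.range M, e i * e (i + m)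

lemma autocorr_eq_zero {e : ℕ → ℝ} {M m : ℕ} (he : ∀ i, M ≤ i → e i = 0) (hm : M ≤ m) :
    autocorr e M m = 0 :=
  Finset.sum_eq_zero fun i _ => by rw [he (i + m) (by omega), mul_zero]

lemma sum_eq_sum_range_of_support {f : ℕ → ℝ} {M N : ℕ} (hf : ∀ i, M ≤ i → f i = 0)
    (hMN : M ≤ N) : ∑ i ∈ Finset.range N, f i = ∑ i ∈ Finset.range M, f i := by
  symm
  refine Finset.sum_subset (Finset.range_mono hMN) fun i _ hi => hf i ?_
  simpa using hi

/-- Expand the square. It is only an inequality because the shifted squares miss the entries with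
index below `m`. -/
lemma sum_sq_sub_le_autocorr {e : ℕ → ℝ} {M : ℕ} (he : ∀ i, M ≤ i → e i = 0) (m N : ℕ) :
    ∑ i ∈ Finset.range N, (e (i + m) - e i) ^ 2 ≤ 2 * autocorr e M 0 - 2 * autocorr e M m := by
  have h1 : ∑ i ∈ Finset.range N, (e (i + m) - e i) ^ 2
      ≤ ∑ i ∈ Finset.range (N + M), (e (i + m) - e i) ^ 2 :=
    Finset.sum_le_sum_of_subset_of_nonneg (Finset.range_mono (by omega)) fun _ _ _ => sq_nonneg _
  have h2 : ∑ i ∈ Finset.range (N + M), e i * e (i + m) = autocorr e M m :=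
    sum_eq_sum_range_of_support (f := fun i => e i * e (i + m))
      (fun i hi => by simp [he i hi]) (by omega)
  have h3 : ∑ i ∈ Finset.range (N + M), e i ^ 2 = autocorr e M 0 := by
    rw [sum_eq_sum_range_of_support (f := fun i => e i ^ 2) (M := M)
      (fun i hi => by simp [he i hi]) (by omega)]
    simp [autocorr, sq]
  have h4 : ∑ i ∈ Finset.range (N + M), e (i + m) ^ 2 ≤ autocorr e M 0 := by
    have h5 : ∑ i ∈ Finset.range (m + (N + M)), e i ^ 2 = autocorr e M 0 := by
      rw [sum_eq_sum_range_of_support (f := fun i => e i ^ 2) (M := M)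
        (fun i hi => by simp [he i hi]) (by omega)]
      simp [autocorr, sq]
    rw [Finset.sum_range_add] at h5
    have : 0 ≤ ∑ i ∈ Finset.range m, e i ^ 2 := Finset.sum_nonneg fun _ _ => sq_nonneg _
    simp_rw [add_comm _ m]
    linarith
  calc _ ≤ _ := h1
    _ = ∑ i ∈ Finset.range (N + M), e (i + m) ^ 2 + ∑ i ∈ Finset.range (N + M), e i ^ 2
        - 2 * ∑ i ∈ Finset.range (N + M), e i * e (i + m) := by
      rw [Finset.mul_sum, ← Finset.sum_add_distrib, ← Finset.sum_sub_distrib]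
      exact Finset.sum_congr rfl fun _ _ => by ring
    _ ≤ _ := by rw [h2, h3]; linarith

/-- The quadratic form of the Toeplitz matrix with symbol `w`, truncated after `L` terms. -/
def toeplitzForm (β : ℝ) (e : ℕ → ℝ) (M L : ℕ) : ℝ :=
  ∑ k ∈ Finset.range L, w β k * (if k = 0 then autocorr e M 1 else autocorr e M (k - 1))

lemma toeplitzForm_eq {β : ℝ} {e : ℕ → ℝ} {M L : ℕ} (he : ∀ i, M ≤ i → e i = 0)
    (hL : M + 1 ≤ L) (hL' : 1 ≤ M) : toeplitzForm β e M L = toeplitzForm β e M (M + 1) := by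
  refine sum_eq_sum_range_of_support (fun k hk => ?_) hL
  rw [if_neg (by omega), autocorr_eq_zero he (by omega), mul_zero]

lemma sum_mul_deltaLeft {β : ℝ} {e : ℕ → ℝ} {M : ℕ} (h0 : e 0 = 0)
    (he : ∀ i, M ≤ i → e i = 0) :
    ∑ j ∈ Finset.range M, e j * ∑ k ∈ Finset.range (j + 1), w β k * e (j + 1 - k)
      = toeplitzForm β e M (M + 1) := by
  have h1 : ∀ j ∈ Finset.range M, e j * ∑ k ∈ Finset.range (j + 1), w β k * e (j + 1 - k)
      = ∑ k ∈ Finset.range (M + 1), w β k * (if k ≤ j + 1 then e j * e (j + 1 - k) else 0) := by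
    intro j hj
    have hj := Finset.mem_range.1 hj
    rw [Finset.mul_sum, ← Finset.sum_subset (Finset.range_mono (show j + 1 ≤ M + 1 by omega))]
    · refine Finset.sum_congr rfl fun k hk => ?_
      rw [if_pos (by have := Finset.mem_range.1 hk; omega)]
      ring
    · intro k _ hk
      have hk : j + 1 ≤ k := by simpa using hk
      -- The scheme stops at `k = j`; the missing term `k = j + 1` carries `e 0 = 0`.
      rcases hk.eq_or_lt with rfl | hk
      · simp [h0]
      · rw [if_neg (by omega), mul_zero]
  rw [Finset.sum_congr rfl h1, Finset.sum_comm]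
  simp_rw [← Finset.mul_sum]
  refine Finset.sum_congr rfl fun k hk => ?_
  congr 1
  rcases k with _ | m
  · simp [autocorr]
  · have hm : m ≤ M := by have := Finset.mem_range.1 hk; omega
    obtain ⟨n, rfl⟩ := Nat.exists_eq_add_of_le hm
    simp only [add_le_add_iff_right, Nat.add_sub_add_right, Nat.add_eq_zero_iff, one_ne_zero, and_false,
      if_false, Nat.add_sub_cancel]
    rw [Finset.sum_range_add, Finset.sum_eq_zero, zero_add]
    · have : autocorr e (m + n) m = ∑ i ∈ Finset.range n, e i * e (i + m) :=
        sum_eq_sum_range_of_support (fun i hi => by rw [he (i + m) (by omega), mul_zero]) (by omega)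
      rw [this]
      refine Finset.sum_congr rfl fun i _ => ?_
      rw [if_pos (by omega), Nat.add_sub_cancel_left, add_comm m i, mul_comm]
    · intro i hi
      rw [if_neg (by have := Finset.mem_range.1 hi; omega)]

lemma sum_mul_deltaRight {β : ℝ} {e : ℕ → ℝ} {M : ℕ} (h0 : e 0 = 0)
    (he : ∀ i, M ≤ i → e i = 0) :
    ∑ j ∈ Finset.range M, e j * ∑ k ∈ Finset.range (M - j + 1), w β k * e (j + k - 1)
      = toeplitzForm β e M (M + 1) := by
  have h1 : ∀ j ∈ Finset.range M, e j * ∑ k ∈ Finset.range (M - j + 1), w β k * e (j + k - 1)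
      = ∑ k ∈ Finset.range (M + 1), w β k * (e j * e (j + k - 1)) := by
    intro j hj
    have hj := Finset.mem_range.1 hj
    rw [Finset.mul_sum, ← sum_eq_sum_range_of_support (M := M - j + 1) (N := M + 1)
      (f := fun k => e j * (w β k * e (j + k - 1)))]
    · exact Finset.sum_congr rfl fun k hk => by ring
    · intro k hk
      simp only [he (j + k - 1) (by omega), mul_zero]
    · omega
  rw [Finset.sum_congr rfl h1, Finset.sum_comm]
  simp_rw [← Finset.mul_sum]
  refine Finset.sum_congr rfl fun k hk => ?_
  congr 1
  rcases k with _ | m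
  · rw [if_pos rfl]
    -- For `j = 0` the truncated index `0 - 1` is `0`; the term vanishes since `e 0 = 0`.
    have h2 := Finset.sum_range_succ' (fun j => e j * e (j + 0 - 1)) M
    rw [Finset.sum_range_succ, he M le_rfl, h0, zero_mul, zero_mul, add_zero, add_zero] at h2
    rw [h2]
    exact Finset.sum_congr rfl fun i _ => by simp [mul_comm]
  · simp [autocorr]

/-- The weight `w β k` couples entries at distance `|k - 1|`, so `w β 1` sits on the diagonal and `w
β 0`, `w β 2` share distance one. -/
lemma sum_w_mul (β : ℝ) (T : ℕ → ℝ) (n : ℕ) :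
    ∑ k ∈ Finset.range (n + 3), w β k * (if k = 0 then T 1 else T (k - 1))
      = w β 1 * T 0 + ∑ m ∈ Finset.range (n + 1), offDiag β (m + 1) * T (m + 1) := by
  induction n with
  | zero => simp [Finset.sum_range_succ, offDiag]; ring
  | succ n ih =>
    rw [Finset.sum_range_succ, ih, Finset.sum_range_succ _ (n + 1)]
    rw [if_neg (by omega), add_assoc]
    rfl

/-- Since the weights have nonpositive sum, `-w β 1` is at least the sum of the off-diagonal
entries. So minus the form is at least the sum of `offDiag β m` times `autocorr e M 0 - autocorr e M
m`, and each such difference dominates half a sum of squared differences. -/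
lemma half_sum_offDiag_le_neg_toeplitzForm {β : ℝ} (hβ : 1 < β) (hβ' : β ≤ 2) {e : ℕ → ℝ} {M : ℕ}
    (hM : 1 ≤ M) (he : ∀ i, M ≤ i → e i = 0) (n N : ℕ) :
    1 / 2 * ∑ m ∈ Finset.range n, offDiag β (m + 1) *
      ∑ i ∈ Finset.range N, (e (i + (m + 1)) - e i) ^ 2 ≤ - toeplitzForm β e M (M + 1) := by
  -- Lengthening the truncation changes nothing, as long-range autocorrelations vanish, and makes
  -- room for the `n` terms on the left.
  rw [← toeplitzForm_eq he (L := (n + M + 1) + 3) (by omega) hM, toeplitzForm, sum_w_mul]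
  have hw := sum_w_nonpos hβ hβ' (n + M)
  have h1 := sum_w_mul β (fun _ => 1) (n + M + 1)
  simp only [ite_self, mul_one] at h1
  change ∑ k ∈ Finset.range (n + M + 1 + 3), w β k ≤ 0 at hw
  rw [h1] at hw
  have hT : 0 ≤ autocorr e M 0 := Finset.sum_nonneg fun i _ => by simpa using mul_self_nonneg (e i)
  have h2 : ∑ m ∈ Finset.range n, offDiag β (m + 1) *
      ∑ i ∈ Finset.range N, (e (i + (m + 1)) - e i) ^ 2
      ≤ ∑ m ∈ Finset.range (n + M + 1 + 1), offDiag β (m + 1) *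
        (2 * autocorr e M 0 - 2 * autocorr e M (m + 1)) := by
    refine (Finset.sum_le_sum_of_subset_of_nonneg
      (Finset.range_mono (show n ≤ n + M + 1 + 1 by omega)) fun m _ _ => ?_).trans
      (Finset.sum_le_sum fun m _ => ?_)
    · exact mul_nonneg (offDiag_nonneg hβ hβ' _) (Finset.sum_nonneg fun _ _ => sq_nonneg _)
    · exact mul_le_mul_of_nonneg_left (sum_sq_sub_le_autocorr he _ _) (offDiag_nonneg hβ hβ' _)
  have h3 : ∑ m ∈ Finset.range (n + M + 1 + 1), offDiag β (m + 1) *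
        (2 * autocorr e M 0 - 2 * autocorr e M (m + 1)) =
      2 * ((∑ m ∈ Finset.range (n + M + 1 + 1), offDiag β (m + 1)) * autocorr e M 0
        - ∑ m ∈ Finset.range (n + M + 1 + 1), offDiag β (m + 1) * autocorr e M (m + 1)) := by
    rw [Finset.sum_mul, ← Finset.sum_sub_distrib, Finset.mul_sum]
    exact Finset.sum_congr rfl fun _ _ => by ring
  nlinarith [mul_nonneg (neg_nonneg.2 hw) hT]

/-! ### Discrete fractional Sobolev inequality by dyadic averages -/

lemma sq_sub_average_le (x y : ℕ → ℝ) {A B : ℕ} (hA : 0 < A) (hB : 0 < B) :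
    ((∑ p ∈ Finset.range A, x p) / A - (∑ q ∈ Finset.range B, y q) / B) ^ 2
      ≤ (∑ p ∈ Finset.range A, ∑ q ∈ Finset.range B, (y q - x p) ^ 2) / (A * B) := by
  have hA' : (0 : ℝ) < A := by positivity
  have hB' : (0 : ℝ) < B := by positivity
  have h := sq_sum_le_card_mul_sum_sq (s := Finset.range A ×ˢ Finset.range B)
    (f := fun z => y z.2 - x z.1)
  simp only [Finset.sum_product, Finset.card_product, Finset.card_range, Finset.sum_sub_distrib,
    Finset.sum_const, nsmul_eq_mul, ← Finset.mul_sum] at h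
  rw [le_div_iff₀ (by positivity)]
  have h2 : (∑ p ∈ Finset.range A, x p) / A - (∑ q ∈ Finset.range B, y q) / B
     = -((A * ∑ q ∈ Finset.range B, y q - B * ∑ p ∈ Finset.range A, x p) / (A * B)) := by
    field_simp; ring
  rw [h2, neg_sq, div_pow, div_mul_eq_mul_div, div_le_iff₀ (by positivity)]
  push_cast at h
  calc _ ≤ _ := mul_le_mul_of_nonneg_right h (by positivity)
    _ = _ := by ring

/-- The average of `e` over the `k`-th dyadic block to the right of `j`. -/
def blockAverage (e : ℕ → ℝ) (j k : ℕ) : ℝ :=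
  (∑ p ∈ Finset.range (2 ^ k), e (j + 2 ^ k - 1 + p)) / (2 ^ k : ℕ)

/-- Two points of adjacent blocks of lengths `n` and `2n` lie at distance between 1 and `3n`, and
each pair is counted once when indexed by its left point and its distance. -/
lemma sum_blocks_le (e : ℕ → ℝ) (j : ℕ) {n : ℕ} (hn : 1 ≤ n) :
    ∑ p ∈ Finset.range n, ∑ q ∈ Finset.range (2 * n),
      (e (j + 2 * n - 1 + q) - e (j + n - 1 + p)) ^ 2
    ≤ ∑ m ∈ Finset.range (3 * n), ∑ i ∈ Finset.range (j + 3 * n),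
      (e (i + (m + 1)) - e i) ^ 2 := by
  have h1 : ∀ p ∈ Finset.range n, ∑ q ∈ Finset.range (2 * n),
      (e (j + 2 * n - 1 + q) - e (j + n - 1 + p)) ^ 2 ≤
      ∑ m ∈ Finset.range (3 * n), (e (j + n - 1 + p + (m + 1)) - e (j + n - 1 + p)) ^ 2 := by
    intro p hp
    have hp := Finset.mem_range.1 hp
    have : ∑ q ∈ Finset.range (2 * n), (e (j + 2 * n - 1 + q) - e (j + n - 1 + p)) ^ 2
        = ∑ m ∈ Finset.Ico (n - p - 1) (n - p - 1 + 2 * n),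
          (e (j + n - 1 + p + (m + 1)) - e (j + n - 1 + p)) ^ 2 := by
      rw [Finset.sum_Ico_eq_sum_range, Nat.add_sub_cancel_left]
      refine Finset.sum_congr rfl fun q _ => ?_
      congr 3
      omega
    rw [this]
    refine Finset.sum_le_sum_of_subset_of_nonneg (fun m hm => ?_) fun _ _ _ => sq_nonneg _
    simp only [Finset.mem_Ico, Finset.mem_range] at hm ⊢
    omega
  refine (Finset.sum_le_sum h1).trans ?_
  rw [Finset.sum_comm]
  refine Finset.sum_le_sum fun m _ => ?_
  have : ∑ p ∈ Finset.range n, (e (j + n - 1 + p + (m + 1)) - e (j + n - 1 + p)) ^ 2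
      = ∑ i ∈ Finset.Ico (j + n - 1) (j + n - 1 + n), (e (i + (m + 1)) - e i) ^ 2 := by
    rw [Finset.sum_Ico_eq_sum_range, Nat.add_sub_cancel_left]
  rw [this]
  refine Finset.sum_le_sum_of_subset_of_nonneg (fun m hm => ?_) fun _ _ _ => sq_nonneg _
  simp only [Finset.mem_Ico, Finset.mem_range] at hm ⊢
  omega

/-- Telescope the block averages from `e j` (block 0) to a block beyond `M`, where the average is
zero. Consecutive averages differ by at most a multiple of `√S · r^k` with `r² = 2^(β-1)`. As `β >
1`, the geometric sum is controlled by its last power, of size `M^((β-1)/2)`. -/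
lemma sq_le_of_slobodeckij_le {β : ℝ} (hβ : 1 < β) : ∃ C > 0, ∀ M : ℕ, 1 ≤ M → ∀ e : ℕ → ℝ,
    (∀ i, M ≤ i → e i = 0) → ∀ S : ℝ,
    (∀ n N : ℕ, ∑ m ∈ Finset.range n, 1 / ((m + 1 : ℕ) : ℝ) ^ (1 + β) *
      ∑ i ∈ Finset.range N, (e (i + (m + 1)) - e i) ^ 2 ≤ S) →
    ∀ j, e j ^ 2 ≤ C * (M : ℝ) ^ (β - 1) * S := by
  set r : ℝ := 2 ^ ((β - 1) / 2) with hr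
  have hr1 : 1 < r := Real.one_lt_rpow (by norm_num) (by linarith)
  -- Distances up to `3n` cost `(3n)^(1+β)`; dividing by the number `2n²` of pairs leaves `C₁
  -- n^(β-1)`.
  set C₁ : ℝ := 3 ^ (1 + β) / 2 with hC₁
  have hC₁0 : 0 < C₁ := by positivity
  have hr0 : 0 < r - 1 := by linarith
  refine ⟨C₁ * 2 ^ (β - 1) / (r - 1) ^ 2, by positivity, fun M hM e he S hS j => ?_⟩
  have hS0 : 0 ≤ S := by simpa using hS 0 0
  have hrsq : ∀ k : ℕ, (r ^ k) ^ 2 = ((2 ^ k : ℕ) : ℝ) ^ (β - 1) := by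
    intro k
    rw [hr, ← Real.rpow_natCast, ← Real.rpow_natCast, ← Real.rpow_mul (by positivity),
      ← Real.rpow_mul (by positivity)]
    push_cast
    rw [← Real.rpow_natCast, ← Real.rpow_mul (by norm_num)]
    congr 1; ring
  have hstep : ∀ k, |blockAverage e j k - blockAverage e j (k + 1)| ≤ √(C₁ * S) * r ^ k := by
    intro k
    apply Real.abs_le_sqrt (y := C₁ * S * (r ^ k) ^ 2) _ |>.trans_eq
    · rw [Real.sqrt_mul (by positivity), Real.sqrt_sq (by positivity)]
    have hn : 1 ≤ 2 ^ k := Nat.one_le_two_pow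
    have h2 : 2 ^ (k + 1) = 2 * 2 ^ k := by ring
    rw [hrsq, blockAverage, blockAverage, h2]
    generalize 2 ^ k = n at hn
    refine (sq_sub_average_le _ _ (by omega) (by omega)).trans ?_
    have hn' : (0 : ℝ) < n := by exact_mod_cast hn
    have h3 := hS (3 * n) (j + 3 * n)
    have h4 : ∑ m ∈ Finset.range (3 * n), ∑ i ∈ Finset.range (j + 3 * n),
        (e (i + (m + 1)) - e i) ^ 2 ≤ (3 * n) ^ (1 + β) * S := by
      refine le_trans ?_ (mul_le_mul_of_nonneg_left h3 (by positivity))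
      rw [Finset.mul_sum]
      refine Finset.sum_le_sum fun m hm => ?_
      rw [← mul_assoc]
      refine le_mul_of_one_le_left (Finset.sum_nonneg fun _ _ => sq_nonneg _) ?_
      rw [mul_one_div, one_le_div (by positivity)]
      refine Real.rpow_le_rpow (by positivity) ?_ (by linarith)
      have := Finset.mem_range.1 hm
      exact_mod_cast this
    rw [div_le_iff₀ (by positivity)]
    refine ((sum_blocks_le e j hn).trans h4).trans_eq ?_
    rw [Real.mul_rpow (by norm_num) hn'.le, show 1 + β = (β - 1) + 2 by ring,
      Real.rpow_add hn', hC₁, show 1 + β = (β - 1) + 2 by ring, Real.rpow_two]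
    push_cast
    ring
  have hsum : ∀ k, |e j| ≤ |blockAverage e j k| + √(C₁ * S) * ∑ l ∈ Finset.range k, r ^ l := by
    intro k
    induction k with
    | zero => simp [blockAverage]
    | succ k ih =>
      rw [Finset.sum_range_succ]
      have := hstep k
      have h5 := abs_sub_abs_le_abs_sub (blockAverage e j k) (blockAverage e j (k + 1))
      linarith
  set K := Nat.log 2 M + 1 with hK
  have hK1 : M < 2 ^ K := Nat.lt_pow_succ_log_self (by norm_num) M
  have hK2 : 2 ^ K ≤ 2 * M := by
    rw [hK, pow_succ, mul_comm]
    exact Nat.mul_le_mul_left 2 (Nat.pow_log_le_self 2 (by omega))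
  have h0 : blockAverage e j K = 0 := by
    rw [blockAverage, Finset.sum_eq_zero, zero_div]
    intro p _
    exact he _ (by omega)
  have h1 := hsum K
  rw [h0, abs_zero, zero_add, geom_sum_eq hr1.ne'] at h1
  have h2 : |e j| ≤ √(C₁ * S) * (r ^ K / (r - 1)) := by
    refine h1.trans ?_
    gcongr
    linarith
  calc e j ^ 2 = |e j| ^ 2 := (sq_abs _).symm
    _ ≤ (√(C₁ * S) * (r ^ K / (r - 1))) ^ 2 := by gcongr
    _ = C₁ * S * ((2 ^ K : ℕ) : ℝ) ^ (β - 1) / (r - 1) ^ 2 := by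
      rw [mul_pow, div_pow, Real.sq_sqrt (by positivity), hrsq]; ring
    _ ≤ C₁ * S * ((2 * M : ℕ) : ℝ) ^ (β - 1) / (r - 1) ^ 2 := by
      gcongr
    _ = _ := by
      push_cast
      rw [Real.mul_rpow (by norm_num) (by positivity)]
      ring

/-- For `β < 2` the off-diagonal entries dominate the Slobodeckij weights. For `β = 2` only
neighbours are coupled, and telescoping with Cauchy–Schwarz replaces the dyadic argument. -/
lemma sq_le_neg_toeplitzForm {β : ℝ} (hβ : 1 < β) (hβ' : β ≤ 2) : ∃ C > 0, ∀ M : ℕ, 1 ≤ M →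
    ∀ e : ℕ → ℝ, (∀ i, M ≤ i → e i = 0) →
    ∀ j, e j ^ 2 ≤ C * (M : ℝ) ^ (β - 1) * (- toeplitzForm β e M (M + 1)) := by
  rcases hβ'.lt_or_eq with hlt | rfl
  · obtain ⟨C, hC, h⟩ := sq_le_of_slobodeckij_le hβ
    obtain ⟨κ, hκ, hoff⟩ := exists_le_offDiag hβ hlt
    refine ⟨C * (2 / κ), by positivity, fun M hM e he j => ?_⟩
    refine (h M hM e he (2 / κ * (- toeplitzForm β e M (M + 1))) (fun n N => ?_) j).trans_eq
      (by ring)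
    have h1 := half_sum_offDiag_le_neg_toeplitzForm hβ hβ' hM he n N
    calc _ ≤ ∑ m ∈ Finset.range n, 1 / κ * (offDiag β (m + 1) *
          ∑ i ∈ Finset.range N, (e (i + (m + 1)) - e i) ^ 2) := by
          refine Finset.sum_le_sum fun m _ => ?_
          rw [← mul_assoc]
          refine mul_le_mul_of_nonneg_right ?_ (Finset.sum_nonneg fun _ _ => sq_nonneg _)
          have := hoff (m + 1) (by omega)
          calc _ = 1 / κ * (κ / ((m + 1 : ℕ) : ℝ) ^ (1 + β)) := by field_simp
            _ ≤ _ := by gcongr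
      _ = 2 / κ * (1 / 2 * ∑ m ∈ Finset.range n, (offDiag β (m + 1) *
          ∑ i ∈ Finset.range N, (e (i + (m + 1)) - e i) ^ 2)) := by rw [← Finset.mul_sum]; ring
      _ ≤ _ := by gcongr
  · have hc := offDiag_one_pos hβ
    refine ⟨2 / offDiag 2 1, by positivity, fun M hM e he j => ?_⟩
    have h1 := half_sum_offDiag_le_neg_toeplitzForm hβ hβ' hM he 1 M
    simp only [Finset.sum_range_one, zero_add] at h1
    have h2 : e j ^ 2 ≤ M * ∑ i ∈ Finset.range M, (e (i + 1) - e i) ^ 2 := by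
      rcases le_or_gt M j with hj | hj
      · rw [he j hj, sq, zero_mul]
        exact mul_nonneg (by positivity) (Finset.sum_nonneg fun _ _ => sq_nonneg _)
      have h3 : e j = -∑ i ∈ Finset.Ico j M, (e (i + 1) - e i) := by
        rw [Finset.sum_Ico_sub _ hj.le, he M le_rfl]; ring
      rw [h3, neg_sq]
      refine sq_sum_le_card_mul_sum_sq.trans ?_
      refine mul_le_mul ?_ ?_ (Finset.sum_nonneg fun _ _ => sq_nonneg _) (by positivity)
      · simp
      · refine Finset.sum_le_sum_of_subset_of_nonneg (fun i hi => ?_) fun _ _ _ => sq_nonneg _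
        simp only [Finset.mem_Ico, Finset.mem_range] at hi ⊢
        omega
    norm_num
    calc e j ^ 2 ≤ _ := h2
      _ = 2 / offDiag 2 1 * M * (1 / 2 * (offDiag 2 1 *
          ∑ i ∈ Finset.range M, (e (i + 1) - e i) ^ 2)) := by field_simp
      _ ≤ 2 / offDiag 2 1 * M * (- toeplitzForm 2 e M (M + 1)) := by gcongr
      _ = _ := by ring

/-- Stability of the scheme in the maximum norm, uniformly in the mesh. -/
theorem scheme_stability {a b α β θ : ℝ} (hab : a < b) (hα : 0 ≤ α)
    (hβ : 1 < β) (hβ' : β ≤ 2) :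
    ∃ C, ∀ M : ℕ, 1 ≤ M → ∀ e : ℕ → ℝ, e 0 = 0 → (∀ i, M ≤ i → e i = 0) → ∀ T, 0 ≤ T →
    (∀ j, 1 ≤ j → j < M → |α * e j - θ * deltaLeft β (step a b M) e j
      - (1 - θ) * deltaRight β (step a b M) M e j| ≤ T) → ∀ j, |e j| ≤ C * T := by
  obtain ⟨C, hC, hsq⟩ := sq_le_neg_toeplitzForm hβ hβ'
  refine ⟨C * (b - a) ^ β, fun M hM e h0 he T hT hres j => ?_⟩
  have hba : 0 < b - a := by linarith
  have hM' : (0 : ℝ) < M := by exact_mod_cast hM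
  set h := step a b M with hh
  have hpos : 0 < h := by rw [hh, step]; positivity
  -- Bounding the work of the residual by `M * (|e J| * T)` at a maximum point `J` lets one factor
  -- `|e J|` be cancelled at the end.
  obtain ⟨J, hJ, hmax⟩ := Finset.exists_max_image (Finset.range M) (fun i => |e i|)
    ⟨0, Finset.mem_range.2 hM⟩
  have hmax' : ∀ i, |e i| ≤ |e J| := fun i => by
    rcases lt_or_ge i M with hi | hi
    · exact hmax i (Finset.mem_range.2 hi)
    · simp [he i hi]
  refine (hmax' j).trans ?_
  have henergy : ∑ i ∈ Finset.range M, e i * (α * e i - θ * deltaLeft β h e i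
      - (1 - θ) * deltaRight β h M e i)
      = α * ∑ i ∈ Finset.range M, e i ^ 2 - 1 / h ^ β * toeplitzForm β e M (M + 1) := by
    have e1 : ∑ i ∈ Finset.range M, e i * deltaLeft β h e i
        = 1 / h ^ β * toeplitzForm β e M (M + 1) := by
      rw [← sum_mul_deltaLeft h0 he, Finset.mul_sum]
      exact Finset.sum_congr rfl fun i _ => by rw [deltaLeft]; ring
    have e2 : ∑ i ∈ Finset.range M, e i * deltaRight β h M e i
        = 1 / h ^ β * toeplitzForm β e M (M + 1) := by
      rw [← sum_mul_deltaRight h0 he, Finset.mul_sum]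
      exact Finset.sum_congr rfl fun i _ => by rw [deltaRight]; ring
    calc _ = α * ∑ i ∈ Finset.range M, e i ^ 2 - θ * ∑ i ∈ Finset.range M, e i * deltaLeft β h e i
          - (1 - θ) * ∑ i ∈ Finset.range M, e i * deltaRight β h M e i := by
          simp_rw [Finset.mul_sum, ← Finset.sum_sub_distrib]
          exact Finset.sum_congr rfl fun i _ => by ring
      _ = _ := by rw [e1, e2]; ring
  have hupper : ∑ i ∈ Finset.range M, e i * (α * e i - θ * deltaLeft β h e i
      - (1 - θ) * deltaRight β h M e i) ≤ M * (|e J| * T) := by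
    have : ∀ i ∈ Finset.range M, e i * (α * e i - θ * deltaLeft β h e i
      - (1 - θ) * deltaRight β h M e i) ≤ |e J| * T := by
      intro i hi
      rcases Nat.eq_zero_or_pos i with rfl | hi0
      · rw [h0, zero_mul]; positivity
      · refine (le_abs_self _).trans ?_
        rw [abs_mul]
        exact mul_le_mul (hmax' i) (hres i hi0 (Finset.mem_range.1 hi)) (abs_nonneg _)
          (abs_nonneg _)
    simpa using Finset.sum_le_sum this
  have hform : - toeplitzForm β e M (M + 1) ≤ h ^ β * (M * (|e J| * T)) := by
    have h1 : 0 ≤ α * ∑ i ∈ Finset.range M, e i ^ 2 :=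
      mul_nonneg hα (Finset.sum_nonneg fun _ _ => sq_nonneg _)
    have h2 : 1 / h ^ β * - toeplitzForm β e M (M + 1) ≤ M * (|e J| * T) := by linarith
    have h3 : 0 < h ^ β := by positivity
    rwa [one_div, inv_mul_le_iff₀ h3] at h2
  have hfin : |e J| ^ 2 ≤ C * (b - a) ^ β * T * |e J| := by
    rw [sq_abs]
    refine (hsq M hM e he J).trans ((mul_le_mul_of_nonneg_left hform (by positivity)).trans_eq ?_)
    -- Uniformity in the mesh: `M^β h^β = (b-a)^β`.
    have : (M : ℝ) ^ (β - 1) * h ^ β * M = (b - a) ^ β := by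
      have h4 : (b - a) = M * h := by rw [hh, step]; field_simp
      rw [h4, Real.mul_rpow hM'.le hpos.le, Real.rpow_sub hM', Real.rpow_one]
      field_simp
    rw [← this]; ring
  rcases (abs_nonneg (e J)).eq_or_lt with hz | hz
  · rw [← hz]; positivity
  · rw [sq] at hfin
    exact le_of_mul_le_mul_right hfin hz

/-! ### Linearity and unique solvability -/

lemma deltaLeft_congr {β h : ℝ} {u v : ℕ → ℝ} {M j : ℕ} (huv : ∀ i ≤ M, u i = v i) (hj : j < M) :
    deltaLeft β h u j = deltaLeft β h v j := by
  rw [deltaLeft, deltaLeft]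
  congr 1
  refine Finset.sum_congr rfl fun k _ => ?_
  rw [huv _ (by omega)]

lemma deltaRight_congr {β h : ℝ} {u v : ℕ → ℝ} {M j : ℕ} (huv : ∀ i ≤ M, u i = v i)
    (hj : j < M) : deltaRight β h M u j = deltaRight β h M v j := by
  rw [deltaRight, deltaRight]
  congr 1
  refine Finset.sum_congr rfl fun k hk => ?_
  have := Finset.mem_range.1 hk
  rw [huv _ (by omega)]

lemma deltaLeft_add_smul (β h c : ℝ) (u v : ℕ → ℝ) (j : ℕ) :
    deltaLeft β h (fun i => u i + c * v i) j = deltaLeft β h u j + c * deltaLeft β h v j := by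
  simp only [deltaLeft, mul_add, Finset.sum_add_distrib, Finset.mul_sum]
  congr 1
  exact Finset.sum_congr rfl fun _ _ => by ring

lemma deltaRight_add_smul (β h c : ℝ) (M : ℕ) (u v : ℕ → ℝ) (j : ℕ) :
    deltaRight β h M (fun i => u i + c * v i) j
      = deltaRight β h M u j + c * deltaRight β h M v j := by
  simp only [deltaRight, mul_add, Finset.sum_add_distrib, Finset.mul_sum]
  congr 1
  exact Finset.sum_congr rfl fun _ _ => by ring

/-- Stability for grid functions which are only prescribed up to the index `M`. -/
theorem scheme_stability' {a b α β θ : ℝ} (hab : a < b) (hα : 0 ≤ α)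
    (hβ : 1 < β) (hβ' : β ≤ 2) :
    ∃ C, ∀ M : ℕ, 1 ≤ M → ∀ e : ℕ → ℝ, e 0 = 0 → e M = 0 → ∀ T, 0 ≤ T →
    (∀ j, 1 ≤ j → j < M → |α * e j - θ * deltaLeft β (step a b M) e j
      - (1 - θ) * deltaRight β (step a b M) M e j| ≤ T) → ∀ j ≤ M, |e j| ≤ C * T := by
  obtain ⟨C, hC⟩ := scheme_stability (θ := θ) hab hα hβ hβ'
  refine ⟨C, fun M hM e h0 hM0 T hT hres j hj => ?_⟩
  set v : ℕ → ℝ := fun i => if i ≤ M then e i else 0 with hv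
  have hve : ∀ i ≤ M, v i = e i := fun i hi => by simp [hv, hi]
  have := hC M hM v (by simp [hv, h0]) (fun i hi => ?_) T hT (fun i hi hi' => ?_) j
  · rwa [hve j hj] at this
  · rcases hi.eq_or_lt with rfl | hi
    · rw [hve _ le_rfl, hM0]
    · simp [hv, not_le.2 hi]
  · rw [hve i hi'.le, deltaLeft_congr hve hi', deltaRight_congr hve hi']
    exact hres i hi hi'

/-- Stability with `T = 0` makes the square linear system injective, hence surjective. Sequences are
compared only up to `M` because the scheme does not see later values. -/
theorem scheme_existsUnique {a b α β θ : ℝ} (hab : a < b) (hα : 0 ≤ α)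
    (hβ : 1 < β) (hβ' : β ≤ 2) (f : ℝ → ℝ) {M : ℕ} (hM : 1 ≤ M) :
    ∃ U : ℕ → ℝ, IsSchemeSolution a b α β θ f M U ∧
      ∀ V : ℕ → ℝ, IsSchemeSolution a b α β θ f M V → ∀ j ≤ M, V j = U j := by
  obtain ⟨C, hC⟩ := scheme_stability' (θ := θ) hab hα hβ hβ'
  let ext : (Fin (M + 1) → ℝ) → ℕ → ℝ := fun x i => if h : i < M + 1 then x ⟨i, h⟩ else 0
  have hext : ∀ (x : Fin (M + 1) → ℝ) (i : Fin (M + 1)), ext x i = x i := fun x i => by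
    simp only [ext, i.2, dif_pos, Fin.eta]
  have hadd : ∀ (c : ℝ) (x y : Fin (M + 1) → ℝ),
      ext (x + c • y) = fun i => ext x i + c * ext y i := fun c x y => by
    ext i
    by_cases h : i < M + 1 <;>
    simp only [ext, h, dif_pos, dif_neg, not_false_eq_true, Pi.add_apply, Pi.smul_apply,
      smul_eq_mul, mul_zero, add_zero]
  -- The boundary conditions enter as identity rows, so that there are `M + 1` equations for `M + 1`
  -- unknowns.
  let row : (ℕ → ℝ) → ℕ → ℝ := fun v j => if j = 0 ∨ j = M then v j else
    α * v j - θ * deltaLeft β (step a b M) v j - (1 - θ) * deltaRight β (step a b M) M v j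
  have hrow : ∀ (c : ℝ) (u v : ℕ → ℝ) (j : ℕ),
      row (fun i => u i + c * v i) j = row u j + c * row v j := fun c u v j => by
    simp only [row]
    split_ifs
    · rfl
    · rw [deltaLeft_add_smul, deltaRight_add_smul]; ring
  let A : (Fin (M + 1) → ℝ) →ₗ[ℝ] (Fin (M + 1) → ℝ) :=
    { toFun := fun x i => row (ext x) i
      map_add' := fun x y => by
        ext i
        have := hadd 1 x y
        rw [one_smul] at this
        simp only [this, Pi.add_apply]
        rw [hrow, one_mul]
      map_smul' := fun c x => by
        ext i
        have := hadd c 0 x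
        rw [zero_add] at this
        have h0 : ext 0 = fun _ => 0 := by ext i; simp [ext]
        have h1 : row (fun _ => 0) i = 0 := by simp [row, deltaLeft, deltaRight]
        simp only [this, Pi.smul_apply, smul_eq_mul, RingHom.id_apply]
        rw [hrow, h0, h1, zero_add] }
  have hinj : Function.Injective A := by
    rw [← LinearMap.ker_eq_bot, LinearMap.ker_eq_bot']
    intro x hx
    have hx' : ∀ i : ℕ, i ≤ M → row (ext x) i = 0 := fun i hi =>
      congrFun hx ⟨i, by omega⟩
    ext i
    have := hC M hM (ext x) (by simpa [row] using hx' 0 (by omega))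
      (by simpa [row] using hx' M le_rfl) 0 le_rfl (fun j hj hj' => by
        have h := hx' j hj'.le
        simp only [row, show ¬ (j = 0 ∨ j = M) by omega, if_false] at h
        rw [h, abs_zero]) i (by omega)
    rw [mul_zero, hext] at this
    simpa using abs_nonpos_iff.1 this
  obtain ⟨x, hx⟩ := LinearMap.injective_iff_surjective.1 hinj
    (fun i => if (i : ℕ) = 0 ∨ (i : ℕ) = M then 0 else f (node a b M i))
  have hx' : ∀ i : ℕ, i ≤ M → row (ext x) i = if i = 0 ∨ i = M then 0 else f (node a b M i) :=
    fun i hi => congrFun hx ⟨i, by omega⟩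
  have hsol : IsSchemeSolution a b α β θ f M (ext x) := by
    refine ⟨fun j hj hj' => ?_, by simpa [row] using hx' 0 (by omega),
      by simpa [row] using hx' M le_rfl⟩
    have h := hx' j hj'.le
    simpa only [row, show ¬ (j = 0 ∨ j = M) by omega, if_false] using h
  refine ⟨ext x, hsol, fun V hV j hj => ?_⟩
  have := hC M hM (fun i => V i + (-1) * ext x i) (by simp [hV.left_boundary, hsol.left_boundary])
    (by simp [hV.right_boundary, hsol.right_boundary]) 0 le_rfl (fun i hi hi' => by
      rw [deltaLeft_add_smul, deltaRight_add_smul]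
      have h1 := hV.equation i hi hi'
      have h2 := hsol.equation i hi hi'
      refine le_of_eq (abs_eq_zero.2 ?_)
      linear_combination h1 - h2) j hj
  rw [mul_zero] at this
  have := abs_nonpos_iff.1 this
  linarith

end WSGD

/-! ### The symbol and its second-order contact with `z^β` -/

namespace WSGD

open Complex Filter Topology Asymptotics

lemma hasSum_g {β : ℝ} {x : ℂ} (hx : ‖x‖ < 1) :
    HasSum (fun k => (g β k : ℂ) * x ^ k) ((1 - x) ^ (β : ℂ)) := by
  have h := (one_add_cpow_hasFPowerSeriesOnBall_zero (a := β)).hasSum (y := -x) (by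
    rw [Metric.mem_eball, edist_zero_right, enorm_neg, ← ofReal_norm, ENNReal.ofReal_lt_one]
    exact hx)
  simp only [binomialSeries_apply, List.ofFn_const, List.prod_replicate, smul_eq_mul] at h
  rw [zero_add, ← sub_eq_add_neg] at h
  have hk : (fun k => (g β k : ℂ) * x ^ k) = fun k => Ring.choose (β : ℂ) k * (-x) ^ k := by
    ext k
    rw [g, neg_pow, ofReal_mul, ofReal_choose]
    push_cast
    ring
  rwa [hk]

lemma hasSum_w {β : ℝ} {x : ℂ} (hx : ‖x‖ < 1) :
    HasSum (fun k => (w β k : ℂ) * x ^ k) ((1 - x) ^ (β : ℂ) *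
      ((β ^ 2 + 3 * β + 2) / 12 + (4 - β ^ 2) / 6 * x + (β ^ 2 - 3 * β + 2) / 12 * x ^ 2)) := by
  have h0 := hasSum_g (β := β) hx
  have h1 := (hasSum_nat_add_iff' 1).2 h0
  have h2 := (hasSum_nat_add_iff' 2).2 h0
  rw [← hasSum_nat_add_iff' 2]
  convert! ((h2.mul_left ((β ^ 2 + 3 * β + 2) / 12 : ℂ)).add
    (h1.mul_left ((4 - β ^ 2) / 6 * x : ℂ))).add
    (h0.mul_left ((β ^ 2 - 3 * β + 2) / 12 * x ^ 2 : ℂ)) using 1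
  · ext k
    rw [w_add_two]
    push_cast
    ring
  · simp only [Finset.sum_range_succ, Finset.sum_range_zero, w, g_zero]
    push_cast
    ring

/-- The symbol of the weighted shifted Grünwald difference operator. -/
def symbol (β : ℝ) (z : ℂ) : ℂ := ∑' k : ℕ, (w β k : ℂ) * exp (-((k : ℂ) - 1) * z)

lemma norm_exp_neg_sub_one_mul_le {z : ℂ} (hz : 0 ≤ z.re) (hz' : z.re ≤ 1) (k : ℕ) :
    ‖exp (-((k : ℂ) - 1) * z)‖ ≤ Real.exp 1 := by
  rw [norm_exp, Real.exp_le_exp]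
  have : (-((k : ℂ) - 1) * z).re = (1 - k) * z.re := by
    simp
  rw [this]
  have : (0 : ℝ) ≤ k := by positivity
  nlinarith

lemma norm_symbol_le {β : ℝ} (hβ : 1 < β) (hβ' : β ≤ 2) {z : ℂ} (hz : 0 ≤ z.re)
    (hz' : z.re ≤ 1) : ‖symbol β z‖ ≤ (∑' k, |w β k|) * Real.exp 1 := by
  have h := (summable_abs_w hβ hβ').mul_right (Real.exp 1)
  rw [← tsum_mul_right]
  refine tsum_of_norm_bounded h.hasSum fun k => ?_
  rw [norm_mul, norm_real, Real.norm_eq_abs]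
  exact mul_le_mul_of_nonneg_left (norm_exp_neg_sub_one_mul_le hz hz' k) (abs_nonneg _)

lemma symbol_eq {β : ℝ} {z : ℂ} (hz : 0 < z.re) : symbol β z = (1 - exp (-z)) ^ (β : ℂ) *
    ((β ^ 2 + 3 * β + 2) / 12 * exp z + (4 - β ^ 2) / 6
      + (β ^ 2 - 3 * β + 2) / 12 * exp (-z)) := by
  have hx : ‖exp (-z)‖ < 1 := by
    rw [norm_exp, Real.exp_lt_one_iff]; simpa using hz
  have h := ((hasSum_w (β := β) hx).mul_left (exp z)).tsum_eq
  rw [symbol]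
  convert h using 1
  · congr 1
    ext k
    rw [← exp_nat_mul, mul_left_comm, ← exp_add]
    congr 2
    ring
  · rw [exp_neg]
    field_simp

/-- Both arguments lie in `(-π/2, π/2)`, so their sum does not reach the branch cut. -/
lemma cpow_eq_mul_of_re_pos {z q : ℂ} (hz : 0 < z.re) (hq : 0 < q.re) (s : ℂ) :
    (z * q) ^ s = z ^ s * q ^ s := by
  have hz0 : z ≠ 0 := by rintro rfl; simp at hz
  have hq0 : q ≠ 0 := by rintro rfl; simp at hq
  have h1 := abs_lt.1 (abs_arg_lt_pi_div_two_iff.2 (Or.inl hz))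
  have h2 := abs_lt.1 (abs_arg_lt_pi_div_two_iff.2 (Or.inl hq))
  rw [cpow_def_of_ne_zero (mul_ne_zero hz0 hq0), cpow_def_of_ne_zero hz0, cpow_def_of_ne_zero hq0,
    ← exp_add, log_mul hz0 hq0 ⟨by linarith [h1.1, h2.1], by linarith [h1.2, h2.2]⟩, add_mul]

lemma one_sub_exp_neg_div_isBigO :
    (fun z : ℂ => (1 - exp (-z)) / z - 1 + z / 2) =O[𝓝[≠] 0] fun z => z ^ 2 := by
  have h1 := (exp_sub_sum_range_isBigO_pow 3).comp_tendsto
    (show Tendsto (fun z : ℂ => -z) (𝓝 0) (𝓝 0) from by simpa using (continuous_neg (G := ℂ)).tendsto 0)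
  have h2 : (fun z : ℂ => ((1 - exp (-z)) / z - 1 + z / 2) * z) =O[𝓝[≠] 0] fun z => z ^ 2 * z := by
    refine ((h1.mono nhdsWithin_le_nhds).neg_left.neg_right).congr' ?_ ?_
    · filter_upwards [self_mem_nhdsWithin] with z hz
      have hz : z ≠ 0 := hz
      simp [Finset.sum_range_succ]
      field_simp
      ring
    · exact Eventually.of_forall fun z => by simp; ring
  have h3 := h2.mul (isBigO_refl (fun z : ℂ => z⁻¹) (𝓝[≠] 0))
  refine h3.congr' ?_ ?_ <;>
  · filter_upwards [self_mem_nhdsWithin] with z hz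
    have hz : z ≠ 0 := hz
    field_simp

lemma tendsto_one_sub_exp_neg_div :
    Tendsto (fun z : ℂ => (1 - exp (-z)) / z - 1) (𝓝[≠] 0) (𝓝 0) := by
  have h1 : Tendsto (fun z : ℂ => z ^ 2) (𝓝[≠] 0) (𝓝 0) :=
    ((continuous_pow 2).tendsto' 0 0 (by simp)).mono_left nhdsWithin_le_nhds
  have h2 : Tendsto (fun z : ℂ => z / 2) (𝓝[≠] 0) (𝓝 0) :=
    ((continuous_id.div_const 2).tendsto' 0 0 (by simp)).mono_left nhdsWithin_le_nhds
  have := (one_sub_exp_neg_div_isBigO.trans_tendsto h1).sub h2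
  simpa using this

/-- The quotient is `1 - z/2 + O(z²)`; take the logarithm, multiply by `β` and exponentiate. -/
lemma cpow_one_sub_exp_neg_div_isBigO (β : ℂ) :
    (fun z : ℂ => ((1 - exp (-z)) / z) ^ β - 1 + β * z / 2) =O[𝓝[≠] 0] fun z => z ^ 2 := by
  set p : ℂ → ℂ := fun z => (1 - exp (-z)) / z - 1 with hp
  have hp0 : Tendsto p (𝓝[≠] 0) (𝓝 0) := tendsto_one_sub_exp_neg_div
  have hid : (fun z : ℂ => z ^ 2) =O[𝓝[≠] 0] fun z => z := by
    have : (fun z : ℂ => z * z) =O[𝓝[≠] 0] fun z => z * 1 :=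
      (isBigO_refl _ _).mul (Tendsto.isBigO_one ℂ (tendsto_id.mono_left (nhdsWithin_le_nhds (a := (0 : ℂ)))))
    simpa [sq] using this
  have hpz : p =O[𝓝[≠] 0] fun z => z := by
    have h1 := (one_sub_exp_neg_div_isBigO.trans hid).sub
      ((isBigO_refl (fun z : ℂ => z) (𝓝[≠] 0)).const_mul_left (1 / 2))
    refine h1.congr_left fun z => ?_
    simp only [hp]; ring
  have hlog : (fun z => log (1 + p z) + z / 2) =O[𝓝[≠] 0] fun z => z ^ 2 := by
    have h1 := (log_sub_self_isBigO.comp_tendsto hp0).trans (hpz.pow 2)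
    refine (h1.add one_sub_exp_neg_div_isBigO).congr_left fun z => ?_
    simp only [hp, Function.comp]; ring
  have hlogz : (fun z => β * log (1 + p z)) =O[𝓝[≠] 0] fun z => z := by
    have h1 := (hlog.trans hid).sub
      ((isBigO_refl (fun z : ℂ => z) (𝓝[≠] 0)).const_mul_left (1 / 2))
    refine (h1.const_mul_left β).congr_left fun z => ?_
    ring
  have hlog0 : Tendsto (fun z => β * log (1 + p z)) (𝓝[≠] 0) (𝓝 0) :=
    hlogz.trans_tendsto (tendsto_id.mono_left nhdsWithin_le_nhds)
  have hexp := ((exp_sub_sum_range_isBigO_pow 2).comp_tendsto hlog0).trans (hlogz.pow 2)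
  refine (hexp.add (hlog.const_mul_left β)).congr' ?_ EventuallyEq.rfl
  filter_upwards [hp0.eventually_ne (show (0 : ℂ) ≠ -1 by norm_num)] with z hz
  have hq : (1 - exp (-z)) / z = 1 + p z := by simp [hp]
  have hq0 : 1 + p z ≠ 0 := fun h => hz (by linear_combination h)
  rw [hq, cpow_def_of_ne_zero hq0, mul_comm (log _)]
  simp [Finset.sum_range_succ, Function.comp]
  ring

/-- The three weights sum to 1 and `λ₁ - λ₋₁ = β/2`, which produces precisely the linear term that
cancels the one of the Grünwald factor. -/
lemma weighted_exp_isBigO (β : ℂ) :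
    (fun z : ℂ => (β ^ 2 + 3 * β + 2) / 12 * exp z + (4 - β ^ 2) / 6
      + (β ^ 2 - 3 * β + 2) / 12 * exp (-z) - 1 - β * z / 2) =O[𝓝 0] fun z => z ^ 2 := by
  have h1 := exp_sub_sum_range_isBigO_pow 2
  have h2 := h1.comp_tendsto
    (show Tendsto (fun z : ℂ => -z) (𝓝 0) (𝓝 0) from by simpa using (continuous_neg (G := ℂ)).tendsto 0)
  have h3 : ((fun z : ℂ => z ^ 2) ∘ fun z : ℂ => -z) = fun z => z ^ 2 := by ext; simp
  rw [h3] at h2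
  refine ((h1.const_mul_left ((β ^ 2 + 3 * β + 2) / 12)).add
    (h2.const_mul_left ((β ^ 2 - 3 * β + 2) / 12))).congr_left fun z => ?_
  simp [Finset.sum_range_succ, Function.comp]
  ring

lemma reduced_symbol_isBigO (β : ℂ) :
    (fun z : ℂ => ((1 - exp (-z)) / z) ^ β * ((β ^ 2 + 3 * β + 2) / 12 * exp z + (4 - β ^ 2) / 6
      + (β ^ 2 - 3 * β + 2) / 12 * exp (-z)) - 1) =O[𝓝[≠] 0] fun z => z ^ 2 := by
  have hA := cpow_one_sub_exp_neg_div_isBigO β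
  have hB := (weighted_exp_isBigO β).mono (nhdsWithin_le_nhds (s := {0}ᶜ))
  have hBc : (fun z : ℂ => (β ^ 2 + 3 * β + 2) / 12 * exp z + (4 - β ^ 2) / 6
      + (β ^ 2 - 3 * β + 2) / 12 * exp (-z)) =O[𝓝[≠] 0] fun _ => (1 : ℂ) := by
    have : Continuous (fun z : ℂ => (β ^ 2 + 3 * β + 2) / 12 * exp z + (4 - β ^ 2) / 6
      + (β ^ 2 - 3 * β + 2) / 12 * exp (-z)) := by fun_prop
    exact ((this.tendsto 0).mono_left nhdsWithin_le_nhds).isBigO_one ℂ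
  have hL : (fun z : ℂ => 1 - β * z / 2) =O[𝓝[≠] 0] fun _ => (1 : ℂ) := by
    have : Continuous (fun z : ℂ => 1 - β * z / 2) := by fun_prop
    exact ((this.tendsto 0).mono_left nhdsWithin_le_nhds).isBigO_one ℂ
  have h1 := hA.mul hBc
  have h2 := hL.mul hB
  simp only [mul_one, one_mul] at h1 h2
  refine ((h1.add h2).sub ((isBigO_refl (fun z : ℂ => z ^ 2) _).const_mul_left
    (β ^ 2 / 4))).congr_left fun z => ?_
  ring

/-- The first bound gives the order `h²`; it comes from Taylor expansion near 0 and from the second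
one elsewhere. The second bound, from absolute summability of the weights, grows only like `‖z‖^β`
and provides an integrable majorant in the frequency. -/
lemma exists_norm_symbol_sub_cpow_le {β : ℝ} (hβ : 1 < β) (hβ' : β ≤ 2) :
    ∃ C > 0, ∀ z : ℂ, 0 < z.re → z.re ≤ 1 →
      ‖symbol β z - z ^ (β : ℂ)‖ ≤ C * ‖z‖ ^ (β + 2) ∧
      ‖symbol β z - z ^ (β : ℂ)‖ ≤ C * (1 + ‖z‖ ^ β) := by
  obtain ⟨C₁, hC₁, h1⟩ := (reduced_symbol_isBigO β).exists_pos
  rw [isBigOWith_iff] at h1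
  have hq : ∀ᶠ z : ℂ in 𝓝[≠] 0, 0 < ((1 - exp (-z)) / z).re := by
    have h2 := (tendsto_one_sub_exp_neg_div.add_const 1)
    simp only [sub_add_cancel, zero_add] at h2
    exact (continuous_re.tendsto 1 |>.comp h2).eventually (lt_mem_nhds (by simp))
  obtain ⟨δ, hδ, hball⟩ := Metric.mem_nhdsWithin_iff.1 (h1.and hq)
  set B := (∑' k, |w β k|) * Real.exp 1 with hB
  have hB0 : 0 ≤ B := mul_nonneg (tsum_nonneg fun _ => abs_nonneg _) (Real.exp_pos _).le
  have hcoarse : ∀ z : ℂ, 0 < z.re → z.re ≤ 1 →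
      ‖symbol β z - z ^ (β : ℂ)‖ ≤ (B + 1) * (1 + ‖z‖ ^ β) := by
    intro z hz hz'
    refine (norm_sub_le _ _).trans ?_
    have h3 := norm_symbol_le hβ hβ' hz.le hz'
    rw [norm_cpow_real]
    have : 0 ≤ ‖z‖ ^ β := by positivity
    nlinarith
  -- Chosen so that `(B + 1) * (1 + ‖z‖ ^ β)` is at most `D * ‖z‖ ^ (β + 2)` once `‖z‖ ≥ δ`.
  set D := (B + 1) * (1 / δ ^ (β + 2) + 1 / δ ^ (2 : ℝ)) with hD
  have hD0 : 0 < D := by positivity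
  refine ⟨max C₁ (max D (B + 1)), by positivity, fun z hz hz' => ⟨?_, ?_⟩⟩
  · have hz0 : z ≠ 0 := by rintro rfl; simp at hz
    have hzn : 0 < ‖z‖ := norm_pos_iff.2 hz0
    rcases lt_or_ge ‖z‖ δ with hlt | hge
    · obtain ⟨h4, h5⟩ := hball (show z ∈ _ from ⟨by simpa using hlt, hz0⟩)
      rw [symbol_eq hz]
      have h6 : 1 - exp (-z) = z * ((1 - exp (-z)) / z) := by field_simp
      rw [h6, cpow_eq_mul_of_re_pos hz h5, mul_assoc]
      rw [← mul_sub_one, norm_mul, norm_cpow_real]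
      calc ‖z‖ ^ β * _ ≤ ‖z‖ ^ β * (C₁ * ‖z ^ 2‖) := by gcongr
        _ = C₁ * ‖z‖ ^ (β + 2) := by
          rw [norm_pow, Real.rpow_add hzn, Real.rpow_two]; ring
        _ ≤ _ := by gcongr; exact le_max_left _ _
    · refine (hcoarse z hz hz').trans ?_
      have h7 : (B + 1) * (1 + ‖z‖ ^ β) ≤ D * ‖z‖ ^ (β + 2) := by
        rw [hD, mul_assoc]
        refine mul_le_mul_of_nonneg_left ?_ (by positivity)
        rw [add_mul]
        refine add_le_add ?_ ?_
        · rw [one_div_mul_eq_div, one_le_div (by positivity)]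
          exact Real.rpow_le_rpow hδ.le hge (by linarith)
        · rw [Real.rpow_add hzn, mul_left_comm]
          refine le_mul_of_one_le_right (by positivity) ?_
          rw [one_div_mul_eq_div, one_le_div (by positivity)]
          exact Real.rpow_le_rpow hδ.le hge (by norm_num)
      refine h7.trans ?_
      gcongr
      exact (le_max_left _ _).trans (le_max_right _ _)
  · refine (hcoarse z hz hz').trans ?_
    gcongr
    exact (le_max_right _ _).trans (le_max_right _ _)

end WSGD

/-! ### The Laplace transform of derivatives and fractional integrals -/

namespace WSGD

open Complex Filter Topology

/-- The bilateral Laplace transform of a real function. -/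
def laplace (f : ℝ → ℝ) (s : ℂ) : ℂ := ∫ x : ℝ, exp (-s * x) * (f x : ℂ)

/-- `e^{-εx} f(x)` is integrable for every `ε > 0`. -/
def ExpIntegrable (f : ℝ → ℝ) : Prop := ∀ ε > 0, Integrable fun x => Real.exp (-ε * x) * f x

lemma ExpIntegrable.integrable {f : ℝ → ℝ} (hf : ExpIntegrable f) {s : ℂ} (hs : 0 < s.re) :
    Integrable fun x : ℝ => exp (-s * x) * (f x : ℂ) := by
  have h := (hf s.re hs).ofReal (𝕜 := ℂ)
  have h2 := h.bdd_mul (f := fun x : ℝ => exp (-(s.im * I) * x)) (c := 1)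
    (by fun_prop) (Eventually.of_forall fun x => by simp [norm_exp])
  refine h2.congr (Eventually.of_forall fun x => ?_)
  simp only [coe_algebraMap, ofReal_mul, ofReal_exp]
  rw [← mul_assoc, ← exp_add]
  congr 2
  conv_rhs => rw [← re_add_im s]
  push_cast
  ring

lemma ExpIntegrable.locallyIntegrable {f : ℝ → ℝ} (hf : ExpIntegrable f) :
    LocallyIntegrable f := by
  have h := (hf 1 one_pos).locallyIntegrable.continuous_mul (g := fun x => Real.exp x)
    (by fun_prop)
  refine h.congr (Eventually.of_forall fun x => ?_)
  simp only
  rw [← mul_assoc, ← Real.exp_add]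
  simp

lemma expIntegrable_of_integrable {f : ℝ → ℝ} {a : ℝ} (hf : Integrable f)
    (h0 : ∀ x < a, f x = 0) : ExpIntegrable f := by
  intro ε hε
  refine (hf.norm.const_mul (Real.exp (-ε * a))).mono'
    ((by fun_prop : Continuous fun x : ℝ => Real.exp (-ε * x)).aestronglyMeasurable.mul
      hf.aestronglyMeasurable) (Eventually.of_forall fun x => ?_)
  rcases lt_or_ge x a with hx | hx
  · simp [h0 x hx]
  · rw [norm_mul, Real.norm_eq_abs, Real.abs_exp]
    refine mul_le_mul_of_nonneg_right ?_ (norm_nonneg _)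
    rw [Real.exp_le_exp]
    nlinarith

lemma integrable_indicator_exp_neg (a : ℝ) {ε : ℝ} (hε : 0 < ε) :
    Integrable (indicator (Ici a) fun x => Real.exp (-ε * x)) := by
  rw [integrable_indicator_iff measurableSet_Ici, integrableOn_Ici_iff_integrableOn_Ioi]
  exact exp_neg_integrableOn_Ioi a hε

/-- Since `J` is the integral of `K` from the left of its support, `|J x|` is at most a constant
times `e^(εx)` for every `ε > 0`. -/
lemma ExpIntegrable.of_hasDerivAt {J K : ℝ → ℝ} {a : ℝ} (hJ : ∀ x, HasDerivAt J (K x) x)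
    (h0 : ∀ x < a, J x = 0) (hK : ExpIntegrable K) : ExpIntegrable J := by
  intro ε' hε'
  -- Half of the exponential weight bounds `J`; the other half makes the result integrable.
  obtain ⟨ε, rfl⟩ : ∃ ε, ε' = 2 * ε := ⟨ε' / 2, by ring⟩
  have hε : 0 < ε := by linarith
  set A := ∫ t, ‖Real.exp (-ε * t) * K t‖ with hA
  have hbound : ∀ x, a ≤ x → |J x| ≤ Real.exp (ε * x) * A := by
    intro x hx
    have hint : IntervalIntegrable K volume (a - 1) x :=
      (hK.locallyIntegrable.integrableOn_isCompact isCompact_uIcc).intervalIntegrable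
    have h1 := intervalIntegral.integral_eq_sub_of_hasDerivAt (fun t _ => hJ t) hint
    rw [h0 (a - 1) (by linarith), sub_zero] at h1
    rw [← h1, ← Real.norm_eq_abs]
    refine (intervalIntegral.norm_integral_le_integral_norm (by linarith)).trans ?_
    rw [intervalIntegral.integral_of_le (by linarith), hA, ← integral_const_mul]
    refine (setIntegral_mono_on (hint.1.norm) (((hK ε hε).norm.const_mul _).integrableOn)
      measurableSet_Ioc fun t ht => ?_).trans (setIntegral_le_integral
      ((hK ε hε).norm.const_mul _) (Eventually.of_forall fun t => by positivity))
    rw [norm_mul, ← mul_assoc, Real.norm_eq_abs (Real.exp _), Real.abs_exp, ← Real.exp_add]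
    refine le_mul_of_one_le_left (norm_nonneg _) (Real.one_le_exp ?_)
    nlinarith [ht.2]
  have hJc : Continuous J := continuous_iff_continuousAt.2 fun x => (hJ x).continuousAt
  refine ((integrable_indicator_exp_neg a hε).const_mul A).mono'
    (by fun_prop) (Eventually.of_forall fun x => ?_)
  rcases lt_or_ge x a with hx | hx
  · simp [h0 x hx, hx]
  · rw [indicator_of_mem (show x ∈ Ici a from hx), norm_mul, Real.norm_eq_abs, Real.abs_exp,
      Real.norm_eq_abs]
    calc _ ≤ Real.exp (-(2 * ε) * x) * (Real.exp (ε * x) * A) := by gcongr; exact hbound x hx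
      _ = A * Real.exp (-ε * x) := by
        rw [← mul_assoc, ← Real.exp_add, mul_comm]; congr 2; ring

/-- The derivative of `exp (-s x) J x` has integral zero, as it and its primitive are integrable; no
boundary values are needed. -/
lemma laplace_of_hasDerivAt {J K : ℝ → ℝ} (hJ : ∀ x, HasDerivAt J (K x) x)
    (hJi : ExpIntegrable J) (hK : ExpIntegrable K) {s : ℂ} (hs : 0 < s.re) :
    laplace K s = s * laplace J s := by
  have h1 : ∀ x : ℝ, HasDerivAt (fun x : ℝ => exp (-s * x) * (J x : ℂ))
      (exp (-s * x) * (K x : ℂ) - s * (exp (-s * x) * (J x : ℂ))) x := fun x => by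
    have h2 : HasDerivAt (fun x : ℝ => exp (-s * x)) (exp (-s * x) * (-s)) x := by
      have := ((hasDerivAt_id (x : ℂ)).const_mul (-s)).cexp.comp_ofReal
      simpa using this
    exact (h2.mul (hJ x).ofReal_comp).congr_deriv (by ring)
  have h3 := integral_eq_zero_of_hasDerivAt_of_integrable h1
    ((hK.integrable hs).sub ((hJi.integrable hs).const_mul s)) (hJi.integrable hs)
  rw [integral_sub (hK.integrable hs) ((hJi.integrable hs).const_mul s), integral_const_mul] at h3
  exact sub_eq_zero.1 h3

lemma integrableOn_rpow_mul_exp_neg {μ r : ℝ} (hμ : 0 < μ) (hr : 0 < r) :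
    IntegrableOn (fun t : ℝ => t ^ (μ - 1) * Real.exp (-r * t)) (Ioi 0) := by
  have := integrableOn_rpow_mul_exp_neg_mul_rpow (s := μ - 1) (p := 1) (by linarith) one_pos hr
  simpa using this

open ProbabilityTheory in
-- For real `s` this is the Gamma integral. Both sides are analytic on the right half-plane, the
-- left one as the complex moment generating function of a measure with density `t^(μ-1)`, so the
-- identity theorem extends it.
lemma integral_rpow_mul_cexp_neg_Ioi {μ : ℝ} (hμ : 0 < μ) {s : ℂ} (hs : 0 < s.re) :
    ∫ t in Ioi (0 : ℝ), ((t ^ (μ - 1) : ℝ) : ℂ) * exp (-s * t)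
      = Real.Gamma μ * s ^ (-(μ : ℂ)) := by
  set ν : Measure ℝ := (volume.restrict (Ioi 0)).withDensity
    (fun t => ENNReal.ofReal (t ^ (μ - 1))) with hν
  have hmeas : Measurable fun t : ℝ => ENNReal.ofReal (t ^ (μ - 1)) := by fun_prop
  have hmgf : ∀ z : ℂ, complexMGF (fun t => -t) ν z
      = ∫ t in Ioi (0 : ℝ), ((t ^ (μ - 1) : ℝ) : ℂ) * exp (-z * t) := fun z => by
    rw [complexMGF, hν, integral_withDensity_eq_integral_toReal_smul hmeas
      (Eventually.of_forall fun _ => ENNReal.ofReal_lt_top)]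
    refine setIntegral_congr_fun measurableSet_Ioi fun t ht => ?_
    rw [ENNReal.toReal_ofReal (Real.rpow_nonneg (le_of_lt ht) _), real_smul]
    push_cast
    congr 2
    ring
  have hset : ∀ z : ℂ, 0 < z.re → z.re ∈ interior (integrableExpSet (fun t => -t) ν) := by
    have : Ioi 0 ⊆ integrableExpSet (fun t => -t) ν := fun r hr => by
      rw [integrableExpSet, mem_ofPred_eq, hν, integrable_withDensity_iff_integrable_smul' hmeas
        (Eventually.of_forall fun _ => ENNReal.ofReal_lt_top)]
      refine (integrableOn_rpow_mul_exp_neg hμ hr).congr_fun (fun t ht => ?_) measurableSet_Ioi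
      simp only
      rw [ENNReal.toReal_ofReal (Real.rpow_nonneg (le_of_lt ht) _), smul_eq_mul]
      congr 2
      ring
    exact fun z hz => interior_mono this (by rwa [isOpen_Ioi.interior_eq])
  set U : Set ℂ := {z | 0 < z.re}
  have hU : IsPreconnected U := (convex_halfSpace_re_gt 0).isPreconnected
  have hf : AnalyticOnNhd ℂ (complexMGF (fun t => -t) ν) U := fun z hz =>
    analyticAt_complexMGF (hset z hz)
  have hg : AnalyticOnNhd ℂ (fun z : ℂ => Real.Gamma μ * z ^ (-(μ : ℂ))) U := fun z hz =>
    analyticAt_const.mul (analyticAt_id.cpow analyticAt_const (Or.inl hz))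
  have hreal : ∀ r : ℝ, 0 < r → complexMGF (fun t => -t) ν r
      = Real.Gamma μ * (r : ℂ) ^ (-(μ : ℂ)) := fun r hr => by
    rw [hmgf]
    have h1 := integral_cpow_mul_exp_neg_mul_Ioi (a := μ) (r := r) (by simpa using hμ) hr
    rw [one_div, inv_cpow _ _ (by rw [arg_ofReal_of_nonneg hr.le]; exact Real.pi_pos.ne),
      ← cpow_neg, Complex.Gamma_ofReal, mul_comm] at h1
    rw [← h1]
    refine setIntegral_congr_fun measurableSet_Ioi fun t ht => ?_
    rw [ofReal_cpow (le_of_lt ht)]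
    push_cast
    rw [neg_mul]
  have hfreq : ∃ᶠ z in 𝓝[≠] (1 : ℂ),
      complexMGF (fun t => -t) ν z = Real.Gamma μ * z ^ (-(μ : ℂ)) := by
    have h1 : Tendsto (fun r : ℝ => (r : ℂ)) (𝓝[≠] 1) (𝓝[≠] 1) := by
      refine tendsto_nhdsWithin_of_tendsto_nhds_of_eventually_within _
        ((continuous_ofReal.tendsto' 1 1 (by simp)).mono_left nhdsWithin_le_nhds) ?_
      filter_upwards [self_mem_nhdsWithin] with r hr
      simpa using hr
    refine h1.frequently (Eventually.frequently ?_)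
    filter_upwards [nhdsWithin_le_nhds (lt_mem_nhds (zero_lt_one (α := ℝ)))] with r hr
    exact hreal r hr
  rw [← hmgf]
  exact hf.eqOn_of_preconnected_of_frequently_eq hg hU (by simp [U]) hfreq hs

open Convolution in
-- The fractional integral is convolution with `t^(μ-1)/Γ(μ)` on `t > 0`, and weighting by `exp (-s
-- x)` preserves convolutions.
lemma laplace_leftRLIntegral {v : ℝ → ℝ} {μ : ℝ} (hμ : 0 ≤ μ) (hv : ExpIntegrable v) {s : ℂ}
    (hs : 0 < s.re) : laplace (leftRLIntegral ⊥ μ v) s = s ^ (-(μ : ℂ)) * laplace v s := by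
  rcases hμ.eq_or_lt with rfl | hμ
  · simp [laplace, leftRLIntegral]
  set k : ℝ → ℂ := indicator (Ioi 0) fun t => ((t ^ (μ - 1) : ℝ) : ℂ) * exp (-s * t) with hk
  have hki : Integrable k := by
    rw [hk, integrable_indicator_iff measurableSet_Ioi]
    refine (integrableOn_rpow_mul_exp_neg hμ hs).mono' (by fun_prop) ?_
    refine (ae_restrict_iff' measurableSet_Ioi).2 (Eventually.of_forall fun t ht => ?_)
    have ht : 0 < t := ht
    rw [norm_mul, norm_real, norm_exp, Real.norm_eq_abs, abs_of_nonneg (by positivity)]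
    simp
  have hkint : ∫ t, k t = Real.Gamma μ * s ^ (-(μ : ℂ)) := by
    rw [hk, integral_indicator measurableSet_Ioi, integral_rpow_mul_cexp_neg_Ioi hμ hs]
  have hconv := integral_convolution (ContinuousLinearMap.mul ℂ ℂ) (hv.integrable hs) hki
  have hG : (Real.Gamma μ : ℂ) ≠ 0 := ofReal_ne_zero.2 (Real.Gamma_pos_of_pos hμ).ne'
  have hpt : ∀ x, ((fun x : ℝ => exp (-s * x) * (v x : ℂ)) ⋆[ContinuousLinearMap.mul ℂ ℂ] k) x
      = Real.Gamma μ * (exp (-s * x) * (leftRLIntegral ⊥ μ v x : ℂ)) := fun x => by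
    have h1 : (leftRLIntegral ⊥ μ v x : ℂ) = 1 / Real.Gamma μ *
        ∫ ζ in Iio x, ((v ζ / (x - ζ) ^ (1 - μ) : ℝ) : ℂ) := by
      have : {ζ : ℝ | (⊥ : EReal) < (ζ : EReal) ∧ ζ < x} = Iio x := by
        ext ζ; simp
      rw [leftRLIntegral, if_neg hμ.ne', this, integral_complex_ofReal]
      push_cast
      rfl
    rw [h1, convolution_def, mul_left_comm, ← mul_assoc _ (1 / _ : ℂ), mul_one_div_cancel hG, one_mul,
      ← integral_const_mul, ← integral_indicator measurableSet_Iio]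
    refine integral_congr_ae (Eventually.of_forall fun ζ => ?_)
    simp only [ContinuousLinearMap.mul_apply', hk]
    rcases lt_or_ge ζ x with hζ | hζ
    · have hpos : 0 < x - ζ := sub_pos.2 hζ
      rw [indicator_of_mem (show x - ζ ∈ Ioi 0 from hpos), indicator_of_mem (show ζ ∈ Iio x from hζ),
        show μ - 1 = -(1 - μ) by ring, Real.rpow_neg hpos.le, div_eq_mul_inv]
      have : exp (-s * x) = exp (-s * ζ) * exp (-s * (x - ζ : ℝ)) := by
        rw [← exp_add]; congr 1; push_cast; ring
      rw [this]
      push_cast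
      ring
    · rw [indicator_of_notMem (show x - ζ ∉ Ioi 0 by simpa using hζ),
        indicator_of_notMem (show ζ ∉ Iio x by simpa using hζ), mul_zero]
  simp_rw [hpt] at hconv
  rw [integral_const_mul, hkint] at hconv
  change _ = laplace v s * _ at hconv
  refine mul_left_cancel₀ hG ?_
  rw [laplace, hconv]
  ring

lemma fourier_exp_neg_mul (f : ℝ → ℝ) (ε ω : ℝ) :
    𝓕 (fun x : ℝ => ((Real.exp (-ε * x) * f x : ℝ) : ℂ)) ω
      = laplace f (ε + 2 * Real.pi * ω * I) := by
  rw [Real.fourier_real_eq_integral_exp_smul, laplace]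
  refine integral_congr_ae (Eventually.of_forall fun x => ?_)
  simp only [smul_eq_mul, ofReal_mul, ofReal_exp]
  rw [← mul_assoc, ← exp_add]
  congr 2
  push_cast
  ring

/-- Inversion of the Laplace transform along a vertical line. -/
lemma laplace_inversion {f : ℝ → ℝ} (hf : Continuous f) (hfi : ExpIntegrable f) {ε : ℝ}
    (hε : 0 < ε) (hL : Integrable fun ω : ℝ => laplace f (ε + 2 * Real.pi * ω * I)) (x : ℝ) :
    (f x : ℂ) = ∫ ω : ℝ, exp ((ε + 2 * Real.pi * ω * I) * x) *
      laplace f (ε + 2 * Real.pi * ω * I) := by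
  have hF : 𝓕 (fun x : ℝ => ((Real.exp (-ε * x) * f x : ℝ) : ℂ))
      = fun ω : ℝ => laplace f (ε + 2 * Real.pi * ω * I) := funext (fourier_exp_neg_mul f ε)
  have h := congrFun (Continuous.fourierInv_fourier_eq
    (f := fun x : ℝ => ((Real.exp (-ε * x) * f x : ℝ) : ℂ)) (by fun_prop)
    (hfi ε hε).ofReal (by rw [hF]; exact hL)) x
  rw [hF, Real.fourierInv_eq'] at h
  have h2 : (f x : ℂ) = exp (ε * x) * ((Real.exp (-ε * x) * f x : ℝ) : ℂ) := by
    push_cast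
    rw [← mul_assoc, ← exp_add]
    simp
  rw [h2, ← h, ← integral_const_mul]
  refine integral_congr_ae (Eventually.of_forall fun ω => ?_)
  simp only [smul_eq_mul]
  rw [← mul_assoc, ← exp_add]
  congr 2
  simp
  ring

end WSGD

/-! ### The truncation error as an integral over a vertical line -/

namespace WSGD

open Complex Filter Topology

lemma natCeil_add_two {β : ℝ} (hβ : 1 < β) (hβ' : β ≤ 2) : ⌈β + 2⌉₊ = 4 := by
  rw [Nat.ceil_eq_iff (by norm_num)]
  push_cast
  constructor <;> linarith

lemma natCeil_eq_two {β : ℝ} (hβ : 1 < β) (hβ' : β ≤ 2) : ⌈β⌉₊ = 2 := by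
  rw [Nat.ceil_eq_iff (by norm_num)]
  push_cast
  constructor <;> linarith

lemma leftRLIntegral_eq_zero {v : ℝ → ℝ} {a : ℝ} (h0 : ∀ x < a, v x = 0) (μ : ℝ) {x : ℝ}
    (hx : x < a) : leftRLIntegral ⊥ μ v x = 0 := by
  rw [leftRLIntegral]
  split_ifs
  · exact h0 x hx
  · rw [setIntegral_eq_zero_of_forall_eq_zero, mul_zero]
    intro ζ hζ
    rw [h0 ζ (hζ.2.trans hx), zero_div]

lemma iteratedDeriv_eq_zero_of_lt {f : ℝ → ℝ} {a : ℝ} (h0 : ∀ x < a, f x = 0) (n : ℕ) :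
    ∀ x < a, iteratedDeriv n f x = 0 := by
  induction n with
  | zero => simpa using h0
  | succ n ih =>
    intro x hx
    rw [iteratedDeriv_succ]
    have : iteratedDeriv n f =ᶠ[𝓝 x] fun _ => 0 := by
      filter_upwards [gt_mem_nhds hx] with y hy using ih y hy
    rw [this.deriv_eq, deriv_const]

/-- The point `ε + 2πiω` of a vertical line. -/
def verticalLine (ε ω : ℝ) : ℂ := ε + 2 * Real.pi * ω * I

@[simp] lemma verticalLine_re (ε ω : ℝ) : (verticalLine ε ω).re = ε := by
  simp [verticalLine]

@[simp] lemma verticalLine_im (ε ω : ℝ) : (verticalLine ε ω).im = 2 * Real.pi * ω := by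
  simp [verticalLine]

lemma continuous_verticalLine (ε : ℝ) : Continuous (verticalLine ε) := by
  unfold verticalLine; fun_prop

lemma verticalLine_ne_zero {ε : ℝ} (hε : 0 < ε) (ω : ℝ) : verticalLine ε ω ≠ 0 := fun h => by
  have := congrArg re h
  simp at this
  exact hε.ne' this

lemma le_norm_verticalLine {ε : ℝ} (hε : 0 ≤ ε) (ω : ℝ) : ε ≤ ‖verticalLine ε ω‖ := by
  have := abs_re_le_norm (verticalLine ε ω)
  rwa [verticalLine_re, abs_of_nonneg hε] at this

lemma abs_le_norm_verticalLine (ε ω : ℝ) : |ω| ≤ ‖verticalLine ε ω‖ := by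
  have := abs_im_le_norm (verticalLine ε ω)
  rw [verticalLine_im, abs_mul, abs_of_pos Real.two_pi_pos] at this
  have h2 : 1 ≤ 2 * Real.pi := by linarith [Real.pi_gt_three]
  nlinarith [abs_nonneg ω]

lemma one_add_sq_le_norm_sq {ε : ℝ} (hε : 0 < ε) (ω : ℝ) :
    1 + ω ^ 2 ≤ (1 / ε ^ 2 + 1) * ‖verticalLine ε ω‖ ^ 2 := by
  have h1 : ω ^ 2 ≤ ‖verticalLine ε ω‖ ^ 2 := by
    rw [← sq_abs ω]
    have := abs_le_norm_verticalLine ε ω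
    gcongr
  have h2 : 1 ≤ 1 / ε ^ 2 * ‖verticalLine ε ω‖ ^ 2 := by
    rw [one_div_mul_eq_div, one_le_div (by positivity)]
    have := le_norm_verticalLine hε.le ω
    gcongr
  linarith

lemma continuous_laplace_verticalLine {f : ℝ → ℝ} {ε : ℝ}
    (hf : Integrable fun x => Real.exp (-ε * x) * f x) :
    Continuous fun ω => laplace f (verticalLine ε ω) := by
  have hf' : Integrable fun x : ℝ => ((Real.exp (-ε * x) * f x : ℝ) : ℂ) := hf.ofReal
  have h := VectorFourier.fourierIntegral_continuous Real.continuous_fourierChar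
    (L := innerₗ ℝ) continuous_inner (μ := volume) hf'
  have : (fun ω => laplace f (verticalLine ε ω))
      = 𝓕 (fun x : ℝ => ((Real.exp (-ε * x) * f x : ℝ) : ℂ)) := by
    ext ω
    rw [fourier_exp_neg_mul, verticalLine]
  rw [this]
  exact h

lemma norm_laplace_le {f : ℝ → ℝ} {a : ℝ} (hf : Integrable f) (h0 : ∀ x < a, f x = 0) {s : ℂ}
    (hs : 0 ≤ s.re) (hs' : s.re ≤ 1) : ‖laplace f s‖ ≤ ∫ x, Real.exp |a| * |f x| := by
  refine norm_integral_le_of_norm_le (hf.abs.const_mul _) (Eventually.of_forall fun x => ?_)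
  rcases lt_or_ge x a with hx | hx
  · simp [h0 x hx]
  · rw [norm_mul, norm_exp, norm_real, Real.norm_eq_abs]
    refine mul_le_mul_of_nonneg_right (Real.exp_le_exp.2 ?_) (abs_nonneg _)
    have : (-s * x).re = -s.re * x := by simp
    rw [this]
    have h1 := neg_abs_le a
    nlinarith [abs_nonneg a]

/-- Support in `[a, ∞)` bounds the exponential by `e^|a|` for `0 < ε < 1`, so dominated convergence
applies. -/
lemma tendsto_laplace_verticalLine {f : ℝ → ℝ} {a : ℝ} (hf : Integrable f)
    (h0 : ∀ x < a, f x = 0) (ω : ℝ) :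
    Tendsto (fun ε => laplace f (verticalLine ε ω)) (𝓝[>] 0) (𝓝 (laplace f (verticalLine 0 ω))) := by
  refine tendsto_integral_filter_of_dominated_convergence (fun x => Real.exp |a| * |f x|) ?_ ?_
    (hf.abs.const_mul _) ?_
  · refine Eventually.of_forall fun ε => ?_
    have : Continuous fun x : ℝ => exp (-verticalLine ε ω * x) := by fun_prop
    exact this.aestronglyMeasurable.mul hf.ofReal.aestronglyMeasurable
  · filter_upwards [Ioo_mem_nhdsGT (show (0 : ℝ) < 1 by norm_num)] with ε hε
    refine Eventually.of_forall fun x => ?_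
    rcases lt_or_ge x a with hx | hx
    · simp [h0 x hx]
    · rw [norm_mul, norm_exp, norm_real, Real.norm_eq_abs]
      refine mul_le_mul_of_nonneg_right (Real.exp_le_exp.2 ?_) (abs_nonneg _)
      have : (-verticalLine ε ω * x).re = -ε * x := by simp
      rw [this]
      have h1 := neg_abs_le a
      nlinarith [abs_nonneg a, hε.1, hε.2]
  · refine Eventually.of_forall fun x => ?_
    have : Continuous fun ε : ℝ => exp (-verticalLine ε ω * x) * (f x : ℂ) := by
      unfold verticalLine; fun_prop
    exact (this.tendsto 0).mono_left nhdsWithin_le_nhds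

/-- A function `v` whose left Riemann-Liouville integral `I` of order `2 - β` has the iterated
derivatives `J 0 = I, …, J 4`, in the form needed for the Laplace transform. -/
structure DerivChain (β a : ℝ) (v : ℝ → ℝ) (J : ℕ → ℝ → ℝ) : Prop where
  continuous : Continuous v
  expIntegrable : ExpIntegrable v
  zero : J 0 = leftRLIntegral ⊥ (2 - β) v
  hasDerivAt : ∀ n < 4, ∀ x, HasDerivAt (J n) (J (n + 1) x) x
  eq_zero : ∀ n, ∀ x < a, J n x = 0
  integrable : Integrable (J 4)

namespace DerivChain

variable {β a : ℝ} {v : ℝ → ℝ} {J : ℕ → ℝ → ℝ}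

lemma expIntegrable_apply (hc : DerivChain β a v J) {n : ℕ} (hn : n ≤ 4) :
    ExpIntegrable (J n) := by
  induction hn using Nat.decreasingInduction with
  | self => exact expIntegrable_of_integrable hc.integrable (hc.eq_zero 4)
  | of_succ k hk ih => exact ExpIntegrable.of_hasDerivAt (hc.hasDerivAt k hk) (hc.eq_zero k) ih

lemma laplace_succ (hc : DerivChain β a v J) {n : ℕ} (hn : n < 4) {s : ℂ} (hs : 0 < s.re) :
    laplace (J (n + 1)) s = s * laplace (J n) s :=
  laplace_of_hasDerivAt (hc.hasDerivAt n hn) (hc.expIntegrable_apply hn.le)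
    (hc.expIntegrable_apply hn) hs

lemma laplace_two (hc : DerivChain β a v J) {s : ℂ} (hs : 0 < s.re) :
    laplace (J 2) s = (s ^ 2)⁻¹ * laplace (J 4) s := by
  have hs0 : s ≠ 0 := by rintro rfl; simp at hs
  rw [hc.laplace_succ (n := 3) (by norm_num) hs, hc.laplace_succ (n := 2) (by norm_num) hs]
  field_simp

/-- Four derivatives contribute `s^4` and the integral of order `2 - β` contributes `s^(β-2)`. -/
lemma laplace_self (hc : DerivChain β a v J) (hβ' : β ≤ 2) {s : ℂ} (hs : 0 < s.re) :
    laplace v s = s ^ (-((β : ℂ) + 2)) * laplace (J 4) s := by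
  have hs0 : s ≠ 0 := by rintro rfl; simp at hs
  have h := laplace_leftRLIntegral (μ := 2 - β) (by linarith) hc.expIntegrable hs
  rw [← hc.zero] at h
  have h2 : laplace (J 4) s = s ^ (4 : ℂ) * laplace (J 0) s := by
    rw [hc.laplace_succ (n := 3) (by norm_num) hs, hc.laplace_succ (n := 2) (by norm_num) hs,
      hc.laplace_succ (n := 1) (by norm_num) hs, hc.laplace_succ (n := 0) (by norm_num) hs]
    norm_cast
    ring
  rw [h2, h, ← mul_assoc, ← mul_assoc, ← cpow_add _ _ hs0, ← cpow_add _ _ hs0]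
  push_cast
  rw [show -((β : ℂ) + 2) + 4 + -(2 - β) = 0 by ring, cpow_zero, one_mul]

lemma integrable_laplace_two (hc : DerivChain β a v J) {ε : ℝ} (hε : 0 < ε) (hε' : ε ≤ 1) :
    Integrable fun ω => laplace (J 2) (verticalLine ε ω) := by
  refine (integrable_inv_one_add_sq.const_mul ((1 / ε ^ 2 + 1) *
    ∫ x, Real.exp |a| * |J 4 x|)).mono'
    (continuous_laplace_verticalLine (hc.expIntegrable_apply (by norm_num) ε hε)).aestronglyMeasurable
    (Eventually.of_forall fun ω => ?_)
  rw [hc.laplace_two (by simpa using hε), norm_mul, norm_inv, norm_pow, mul_right_comm]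
  have hpos : 0 < ‖verticalLine ε ω‖ := hε.trans_le (le_norm_verticalLine hε.le ω)
  refine mul_le_mul ?_ (norm_laplace_le hc.integrable (hc.eq_zero 4) (by simpa using hε.le)
    (by simpa using hε')) (norm_nonneg _) (by positivity)
  rw [← div_eq_mul_inv, le_div_iff₀ (by positivity), inv_mul_le_iff₀ (by positivity), mul_comm]
  exact one_add_sq_le_norm_sq hε ω

lemma integrable_laplace_self (hc : DerivChain β a v J) (hβ : 1 < β) (hβ' : β ≤ 2) {ε : ℝ}
    (hε : 0 < ε) (hε' : ε ≤ 1) : Integrable fun ω => laplace v (verticalLine ε ω) := by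
  refine ((hc.integrable_laplace_two hε hε').norm.const_mul (ε ^ (-β))).mono'
    (continuous_laplace_verticalLine (hc.expIntegrable ε hε)).aestronglyMeasurable
    (Eventually.of_forall fun ω => ?_)
  have hpos : 0 < ‖verticalLine ε ω‖ := hε.trans_le (le_norm_verticalLine hε.le ω)
  rw [hc.laplace_two (by simpa using hε), hc.laplace_self hβ' (by simpa using hε), norm_mul,
    norm_mul, ← mul_assoc]
  refine mul_le_mul_of_nonneg_right ?_ (norm_nonneg _)
  have : (-((β : ℂ) + 2)) = ((-β - 2 : ℝ) : ℂ) := by push_cast; ring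
  rw [this, norm_cpow_real, Real.rpow_sub hpos, Real.rpow_two, norm_inv, norm_pow, div_eq_mul_inv]
  refine mul_le_mul_of_nonneg_right ?_ (by positivity)
  exact Real.rpow_le_rpow_of_nonpos hε (le_norm_verticalLine hε.le ω) (by linarith)

/-- The truncation error of the difference operator on the whole line, as an inverse Laplace
transform. -/
lemma truncation_eq_integral (hc : DerivChain β a v J) (hβ : 1 < β) (hβ' : β ≤ 2) {ε h : ℝ}
    (hε : 0 < ε) (hε' : ε ≤ 1) (hh : 0 < h) (x : ℝ) :
    ((1 / h ^ β * ∑' k : ℕ, w β k * v (x - (k - 1) * h) - J 2 x : ℝ) : ℂ) =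
      ∫ ω, exp (verticalLine ε ω * x) * (laplace (J 4) (verticalLine ε ω) *
        (verticalLine ε ω ^ (-((β : ℂ) + 2)) * (1 / h ^ β : ℝ) *
          (symbol β (verticalLine ε ω * h) - (verticalLine ε ω * h) ^ (β : ℂ)))) := by
  have hvi := hc.integrable_laplace_self hβ hβ' hε hε'
  have hJ2c : Continuous (J 2) := continuous_iff_continuousAt.2 fun x =>
    (hc.hasDerivAt 2 (by norm_num) x).continuousAt
  have hJ2i := hc.integrable_laplace_two hε hε'
  have hexpi : ∀ {F : ℝ → ℂ} (y : ℝ), Integrable F →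
      Integrable fun ω => exp (verticalLine ε ω * y) * F ω := fun y hF => by
    refine hF.bdd_mul (c := Real.exp (ε * y)) ?_ (Eventually.of_forall fun ω => ?_)
    · have := continuous_verticalLine ε
      exact Continuous.aestronglyMeasurable (by fun_prop)
    · simp [norm_exp]
  have hv := fun y => laplace_inversion hc.continuous hc.expIntegrable hε hvi y
  have hJ2 := laplace_inversion hJ2c (hc.expIntegrable_apply (by norm_num)) hε hJ2i x
  change ∀ y : ℝ, (v y : ℂ) = ∫ ω : ℝ, exp (verticalLine ε ω * y) *
    laplace v (verticalLine ε ω) at hv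
  change (J 2 x : ℂ) = ∫ ω : ℝ, exp (verticalLine ε ω * x) *
    laplace (J 2) (verticalLine ε ω) at hJ2
  -- Sum and integral may be exchanged: all evaluation points are at most `x + h`, so the
  -- exponentials are bounded by `e^(ε(x+h))` and the weights are absolutely summable.
  have hsum := hasSum_integral_of_summable_integral_norm
    (F := fun (k : ℕ) ω => (w β k : ℂ) * (exp (verticalLine ε ω * (x - (k - 1) * h : ℝ)) *
      laplace v (verticalLine ε ω)))
    (fun k => (hexpi _ hvi).const_mul _) (by
      refine Summable.of_nonneg_of_le (fun k => integral_nonneg fun ω => norm_nonneg _)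
        (fun k => ?_) ((summable_abs_w hβ hβ').mul_right
          (∫ ω, Real.exp (ε * (x + h)) * ‖laplace v (verticalLine ε ω)‖))
      rw [← integral_const_mul]
      refine integral_mono ((hexpi _ hvi).const_mul _).norm
        ((hvi.norm.const_mul _).const_mul _) fun ω => ?_
      simp only [norm_mul, norm_real, Real.norm_eq_abs, norm_exp]
      refine mul_le_mul_of_nonneg_left (mul_le_mul_of_nonneg_right (Real.exp_le_exp.2 ?_)
        (norm_nonneg _)) (abs_nonneg _)
      simp only [mul_re, verticalLine_re, ofReal_re, ofReal_im, mul_zero, sub_zero]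
      refine mul_le_mul_of_nonneg_left ?_ hε.le
      have : 0 ≤ (k : ℝ) * h := by positivity
      linarith)
  simp_rw [integral_const_mul, ← hv] at hsum
  have htsum : ∀ ω, ∑' k : ℕ, (w β k : ℂ) * (exp (verticalLine ε ω * (x - (k - 1) * h : ℝ)) *
      laplace v (verticalLine ε ω)) = exp (verticalLine ε ω * x) * (symbol β (verticalLine ε ω * h)
        * laplace v (verticalLine ε ω)) := fun ω => by
    rw [symbol, ← tsum_mul_right, ← tsum_mul_left]
    congr 1
    ext k
    have : exp (verticalLine ε ω * (x - (k - 1) * h : ℝ)) = exp (verticalLine ε ω * x) *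
        exp (-((k : ℂ) - 1) * (verticalLine ε ω * h)) := by
      rw [← exp_add]; congr 1; push_cast; ring
    rw [this]
    ring
  simp_rw [htsum] at hsum
  have hterm : ∀ (k : ℕ) (ω : ℝ), ‖(w β k : ℂ) * exp (-((k : ℂ) - 1) * (verticalLine ε ω * h))‖
      ≤ |w β k| * Real.exp (ε * h) := fun k ω => by
    rw [norm_mul, norm_real, Real.norm_eq_abs, norm_exp]
    refine mul_le_mul_of_nonneg_left (Real.exp_le_exp.2 ?_) (abs_nonneg _)
    have : (-((k : ℂ) - 1) * (verticalLine ε ω * h)).re = (1 - k) * (ε * h) := by simp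
    rw [this]
    have : 0 ≤ (k : ℝ) * (ε * h) := by positivity
    linarith
  have hsymi : Integrable fun ω => exp (verticalLine ε ω * x) * (symbol β (verticalLine ε ω * h)
        * laplace v (verticalLine ε ω)) := by
    refine hexpi x (hvi.bdd_mul (c := ∑' k, |w β k| * Real.exp (ε * h)) ?_
      (Eventually.of_forall fun ω => ?_))
    · refine (continuous_tsum (fun k => ?_) ((summable_abs_w hβ hβ').mul_right _)
        fun k ω => hterm k ω).aestronglyMeasurable
      have := continuous_verticalLine ε
      fun_prop
    · exact tsum_of_norm_bounded ((summable_abs_w hβ hβ').mul_right _).hasSum fun k => hterm k ω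
  push_cast
  rw [hsum.tsum_eq, hJ2, ← integral_const_mul, ← integral_sub (hsymi.const_mul _) (hexpi x hJ2i)]
  refine integral_congr_ae (Eventually.of_forall fun ω => ?_)
  have hre : 0 < (verticalLine ε ω).re := by simpa using hε
  have hne := verticalLine_ne_zero hε ω
  simp only
  rw [hc.laplace_two hre, hc.laplace_self hβ' hre, cpow_eq_mul_of_re_pos hre (by simpa using hh)]
  have h1 : ((h : ℂ) ^ (β : ℂ)) ≠ 0 := by
    rw [← ofReal_cpow hh.le]; exact ofReal_ne_zero.2 (by positivity)
  have h2 : verticalLine ε ω ^ (-((β : ℂ) + 2)) * verticalLine ε ω ^ (β : ℂ)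
      = (verticalLine ε ω ^ 2)⁻¹ := by
    rw [← cpow_add _ _ hne, show -((β : ℂ) + 2) + β = -2 by ring, cpow_neg]
    norm_cast
  rw [ofReal_cpow hh.le, ← h2]
  field_simp

end DerivChain

end WSGD

/-! ### Second-order consistency on the whole line -/

namespace WSGD

open Complex Filter Topology

/-- The truncation error of the difference operator with step `h` is `O(h²)` uniformly on the line. -/
lemma DerivChain.exists_truncation_le {β a : ℝ} {v : ℝ → ℝ} {J : ℕ → ℝ → ℝ}
    (hc : DerivChain β a v J) (hβ : 1 < β) (hβ' : β ≤ 2)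
    (hF : Integrable (𝓕 fun x : ℝ => (J 4 x : ℂ))) :
    ∃ C, ∀ h, 0 < h → ∀ x : ℝ,
      |1 / h ^ β * ∑' k : ℕ, w β k * v (x - (k - 1) * h) - J 2 x| ≤ C * h ^ 2 := by
  obtain ⟨C, hC, hsym⟩ := exists_norm_symbol_sub_cpow_le hβ hβ'
  have hF' : Integrable fun ω => laplace (J 4) (verticalLine 0 ω) := by
    refine hF.congr (Eventually.of_forall fun ω => ?_)
    have := fourier_exp_neg_mul (J 4) 0 ω
    simp only [neg_zero, zero_mul, Real.exp_zero, one_mul] at this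
    simp only [this, verticalLine]
  refine ⟨C * ∫ ω, ‖laplace (J 4) (verticalLine 0 ω)‖, fun h hh x => ?_⟩
  -- The multiplier is bounded by `C h²` times the minimum of 1 and an integrable function of `ω`.
  -- The latter depends on `h` and serves only to dominate the limit `ε → 0`.
  set B : ℝ := 2 * (1 + (1 / h ^ (β + 2) + 1 / h ^ 2)) with hB
  set m : ℝ → ℝ := fun ω => min 1 (B * (1 + ω ^ 2)⁻¹) with hm
  have hB0 : 0 < B := by positivity
  have hm0 : ∀ ω, 0 ≤ m ω := fun ω => le_min zero_le_one (by positivity)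
  have hmc : Continuous m := by
    have : ∀ ω : ℝ, 1 + ω ^ 2 ≠ 0 := fun ω => by positivity
    exact continuous_const.min (continuous_const.mul (Continuous.inv₀ (by fun_prop) this))
  have hmult : ∀ ε, 0 < ε → ε ≤ 1 → ε * h ≤ 1 → ∀ ω,
      ‖verticalLine ε ω ^ (-((β : ℂ) + 2)) * (1 / h ^ β : ℝ) *
        (symbol β (verticalLine ε ω * h) - (verticalLine ε ω * h) ^ (β : ℂ))‖
      ≤ C * h ^ 2 * m ω := by
    intro ε hε hε' hεh ω
    set s := verticalLine ε ω with hs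
    have hpos : 0 < ‖s‖ := hε.trans_le (le_norm_verticalLine hε.le ω)
    have hre : (s * h).re = ε * h := by simp [hs]
    obtain ⟨h1, h2⟩ := hsym (s * h) (by rw [hre]; positivity) (by rw [hre]; exact hεh)
    have hnorm : ‖s * h‖ = ‖s‖ * h := by rw [norm_mul, norm_real, Real.norm_of_nonneg hh.le]
    rw [hnorm] at h1 h2
    have hcast : (-((β : ℂ) + 2)) = ((-(β + 2) : ℝ) : ℂ) := by push_cast; ring
    rw [norm_mul, norm_mul, hcast, norm_cpow_real, norm_real, Real.norm_of_nonneg (by positivity),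
      Real.rpow_neg hpos.le]
    have hfine : (‖s‖ ^ (β + 2))⁻¹ * (1 / h ^ β) * (C * (‖s‖ * h) ^ (β + 2)) = C * h ^ 2 := by
      rw [Real.mul_rpow hpos.le hh.le, Real.rpow_add hh, Real.rpow_two]
      field_simp
    rw [hm, mul_min_of_nonneg _ _ (by positivity), mul_one]
    refine le_min ((mul_le_mul_of_nonneg_left h1 (by positivity)).trans_eq hfine) ?_
    rcases lt_or_ge |ω| 1 with hω | hω
    · refine ((mul_le_mul_of_nonneg_left h1 (by positivity)).trans_eq hfine).trans ?_
      refine le_mul_of_one_le_right (by positivity) ?_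
      rw [← div_eq_mul_inv, one_le_div (by positivity)]
      have h3 : ω ^ 2 ≤ 1 := by rw [← sq_abs]; nlinarith [abs_nonneg ω]
      have h4 : 0 ≤ 1 / h ^ (β + 2) + 1 / h ^ 2 := by positivity
      rw [hB]; linarith
    · refine (mul_le_mul_of_nonneg_left h2 (by positivity)).trans ?_
      have hsω := abs_le_norm_verticalLine ε ω
      have hs1 : 1 ≤ ‖s‖ := hω.trans hsω
      have h3 : (‖s‖ ^ 2)⁻¹ ≤ 2 * (1 + ω ^ 2)⁻¹ := by
        have h5 : ω ^ 2 ≤ ‖s‖ ^ 2 := by rw [← sq_abs ω]; gcongr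
        have h6 : 1 ≤ ‖s‖ ^ 2 := one_le_pow₀ hs1
        rw [← div_eq_mul_inv, inv_eq_one_div, div_le_div_iff₀ (by positivity) (by positivity)]
        linarith
      have h4 : (‖s‖ ^ (β + 2))⁻¹ ≤ (‖s‖ ^ 2)⁻¹ := by
        rw [Real.rpow_add hpos, Real.rpow_two]
        gcongr
        exact le_mul_of_one_le_left (by positivity) (Real.one_le_rpow hs1 (by linarith))
      calc (‖s‖ ^ (β + 2))⁻¹ * (1 / h ^ β) * (C * (1 + (‖s‖ * h) ^ β))
          = C * h ^ 2 * ((‖s‖ ^ (β + 2))⁻¹ * (1 / h ^ (β + 2)) + (‖s‖ ^ 2)⁻¹ * (1 / h ^ 2)) := by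
            rw [Real.mul_rpow hpos.le hh.le, Real.rpow_add hh, Real.rpow_add hpos, Real.rpow_two,
              Real.rpow_two]
            field_simp
        _ ≤ C * h ^ 2 * ((2 * (1 + ω ^ 2)⁻¹) * (1 / h ^ (β + 2))
              + (2 * (1 + ω ^ 2)⁻¹) * (1 / h ^ 2)) := by
            gcongr
            exact h4.trans h3
        _ ≤ C * h ^ 2 * (B * (1 + ω ^ 2)⁻¹) := by
            rw [hB]
            have : 0 ≤ (1 + ω ^ 2)⁻¹ := by positivity
            gcongr
            linarith
  set K := ∫ x, Real.exp |a| * |J 4 x| with hK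
  have hsmall : ∀ᶠ ε : ℝ in 𝓝[>] 0, 0 < ε ∧ ε ≤ 1 ∧ ε * h ≤ 1 := by
    filter_upwards [Ioo_mem_nhdsGT (show (0 : ℝ) < min 1 (1 / h) by positivity)] with ε hε
    have h1 := hε.2.le.trans (min_le_right _ _)
    exact ⟨hε.1, hε.2.le.trans (min_le_left _ _), (le_div_iff₀ hh).1 h1⟩
  have hlap : ∀ ε, 0 ≤ ε → ε ≤ 1 → ∀ ω, ‖laplace (J 4) (verticalLine ε ω)‖ ≤ K :=
    fun ε hε hε' ω => norm_laplace_le hc.integrable (hc.eq_zero 4) (by simpa using hε)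
      (by simpa using hε')
  have hmi : Integrable fun ω => K * m ω := by
    refine ((integrable_inv_one_add_sq.const_mul B).mono' hmc.aestronglyMeasurable
      (Eventually.of_forall fun ω => ?_)).const_mul K
    rw [Real.norm_of_nonneg (hm0 ω)]
    exact min_le_right _ _
  have hdom : ∀ ε, 0 < ε → ε ≤ 1 → ∀ ω, ‖‖laplace (J 4) (verticalLine ε ω)‖ * m ω‖ ≤ K * m ω :=
    fun ε hε hε' ω => by
      rw [Real.norm_of_nonneg (mul_nonneg (norm_nonneg _) (hm0 ω))]
      exact mul_le_mul_of_nonneg_right (hlap ε hε.le hε' ω) (hm0 ω)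
  have hmeas : ∀ ε, 0 < ε → AEStronglyMeasurable
      (fun ω => ‖laplace (J 4) (verticalLine ε ω)‖ * m ω) := fun ε hε =>
    ((continuous_laplace_verticalLine (hc.expIntegrable_apply le_rfl ε hε)).norm.mul
      hmc).aestronglyMeasurable
  have hbound : ∀ᶠ ε : ℝ in 𝓝[>] 0,
      |1 / h ^ β * ∑' k : ℕ, w β k * v (x - (k - 1) * h) - J 2 x| ≤
      C * h ^ 2 * Real.exp (ε * x) * ∫ ω, ‖laplace (J 4) (verticalLine ε ω)‖ * m ω := by
    filter_upwards [hsmall] with ε ⟨hε, hε', hεh⟩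
    rw [← Real.norm_eq_abs, ← norm_real, hc.truncation_eq_integral hβ hβ' hε hε' hh x,
      ← integral_const_mul]
    refine norm_integral_le_of_norm_le ((hmi.mono' (hmeas ε hε)
      (Eventually.of_forall (hdom ε hε hε'))).const_mul _) (Eventually.of_forall fun ω => ?_)
    rw [norm_mul, norm_mul]
    have h1 : ‖exp (verticalLine ε ω * x)‖ = Real.exp (ε * x) := by simp [norm_exp]
    rw [h1]
    calc _ ≤ Real.exp (ε * x) * (‖laplace (J 4) (verticalLine ε ω)‖ * (C * h ^ 2 * m ω)) := by
          gcongr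
          exact hmult ε hε hε' hεh ω
      _ = _ := by ring
  have hlim : Tendsto (fun ε : ℝ => C * h ^ 2 * Real.exp (ε * x) *
      ∫ ω, ‖laplace (J 4) (verticalLine ε ω)‖ * m ω) (𝓝[>] 0)
      (𝓝 (C * h ^ 2 * Real.exp (0 * x) * ∫ ω, ‖laplace (J 4) (verticalLine 0 ω)‖ * m ω)) := by
    refine Tendsto.mul ?_ (tendsto_integral_filter_of_dominated_convergence _ ?_ ?_ hmi ?_)
    · have : Continuous fun ε : ℝ => C * h ^ 2 * Real.exp (ε * x) := by fun_prop
      exact (this.tendsto 0).mono_left nhdsWithin_le_nhds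
    · filter_upwards [hsmall] with ε hε using hmeas ε hε.1
    · filter_upwards [hsmall] with ε hε using Eventually.of_forall (hdom ε hε.1 hε.2.1)
    · exact Eventually.of_forall fun ω =>
        (tendsto_laplace_verticalLine hc.integrable (hc.eq_zero 4) ω).norm.mul_const _
  -- After the limit, `m ≤ 1` removes the dependence on `B` and leaves the `L¹` norm of the Fourier
  -- transform.
  refine (ge_of_tendsto hlim hbound).trans ?_
  rw [zero_mul, Real.exp_zero, mul_one, mul_right_comm C (∫ ω, _)]
  refine mul_le_mul_of_nonneg_left (integral_mono_of_nonneg (Eventually.of_forall fun ω =>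
    mul_nonneg (norm_nonneg _) (hm0 ω)) hF'.norm (Eventually.of_forall fun ω => ?_)) (by positivity)
  exact mul_le_of_le_one_right (norm_nonneg _) (min_le_left _ _)

/-- The orders `β` and `β + 2` have the same fractional part, so both derivatives are iterated
derivatives, the second and the fourth, of one integral of order `2 - β`. -/
theorem exists_truncation_left_le {β a : ℝ} {v : ℝ → ℝ} (hβ : 1 < β) (hβ' : β ≤ 2)
    (hv : Continuous v) (hvi : Integrable v) (h0 : ∀ x < a, v x = 0)
    (hd : LeftRLDifferentiableOn ⊥ (β + 2) v univ)
    (hD : Integrable (leftRLDeriv ⊥ (β + 2) v))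
    (hF : Integrable (𝓕 fun x : ℝ => (leftRLDeriv ⊥ (β + 2) v x : ℂ))) :
    ∃ C, ∀ h, 0 < h → ∀ x : ℝ,
      |1 / h ^ β * ∑' k : ℕ, w β k * v (x - (k - 1) * h) - leftRLDeriv ⊥ β v x| ≤ C * h ^ 2 := by
  have h4 := natCeil_add_two hβ hβ'
  have hord : ((4 : ℕ) : ℝ) - (β + 2) = 2 - β := by push_cast; ring
  rw [LeftRLDifferentiableOn, h4, hord] at hd
  have hDeq : leftRLDeriv ⊥ (β + 2) v = iteratedDeriv 4 (leftRLIntegral ⊥ (2 - β) v) := by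
    ext x; rw [leftRLDeriv, h4, hord]
  rw [hDeq] at hD hF
  have hc : DerivChain β a v (fun n => iteratedDeriv n (leftRLIntegral ⊥ (2 - β) v)) :=
    { continuous := hv
      expIntegrable := expIntegrable_of_integrable hvi h0
      zero := iteratedDeriv_zero
      hasDerivAt := fun n hn x => by
        rw [iteratedDeriv_succ]
        exact (hd n hn x (mem_univ x)).hasDerivAt
      eq_zero := iteratedDeriv_eq_zero_of_lt fun x hx => leftRLIntegral_eq_zero h0 _ hx
      integrable := hD }
  obtain ⟨C, hC⟩ := hc.exists_truncation_le hβ hβ' hF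
  refine ⟨C, fun h hh x => ?_⟩
  have := hC h hh x
  rwa [leftRLDeriv, natCeil_eq_two hβ hβ', Nat.cast_ofNat]

lemma leftRLIntegral_comp_neg (μ : ℝ) (v : ℝ → ℝ) (x : ℝ) :
    leftRLIntegral ⊥ μ (fun y => v (-y)) x = rightRLIntegral ⊤ μ v (-x) := by
  rw [leftRLIntegral, rightRLIntegral]
  split_ifs
  · rfl
  congr 1
  have h1 : {ζ : ℝ | (⊥ : EReal) < (ζ : EReal) ∧ ζ < x} = Iio x := by ext ζ; simp
  have h2 : {ζ : ℝ | -x < ζ ∧ (ζ : EReal) < ⊤} = Ioi (-x) := by ext ζ; simp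
  rw [h1, h2, ← integral_Iic_eq_integral_Iio, ← integral_comp_neg_Iic]
  refine setIntegral_congr_fun measurableSet_Iic fun ζ _ => ?_
  rw [show -ζ - -x = x - ζ by ring]

lemma iteratedDeriv_leftRLIntegral_comp_neg (n : ℕ) (μ : ℝ) (v : ℝ → ℝ) (x : ℝ) :
    iteratedDeriv n (leftRLIntegral ⊥ μ (fun y => v (-y))) x
      = (-1) ^ n * iteratedDeriv n (rightRLIntegral ⊤ μ v) (-x) := by
  rw [funext (leftRLIntegral_comp_neg μ v), iteratedDeriv_comp_neg, smul_eq_mul]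

lemma leftRLDeriv_comp_neg (σ : ℝ) (v : ℝ → ℝ) (x : ℝ) :
    leftRLDeriv ⊥ σ (fun y => v (-y)) x = rightRLDeriv ⊤ σ v (-x) := by
  rw [leftRLDeriv, rightRLDeriv, iteratedDeriv_leftRLIntegral_comp_neg]

/-- Reflect `x ↦ -x`: the sign `(-1)^n` in the right derivative is the one produced by the chain
rule, and the Fourier transform is reflected too. -/
theorem exists_truncation_right_le {β b : ℝ} {v : ℝ → ℝ} (hβ : 1 < β) (hβ' : β ≤ 2)
    (hv : Continuous v) (hvi : Integrable v) (h0 : ∀ x, b < x → v x = 0)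
    (hd : RightRLDifferentiableOn ⊤ (β + 2) v univ)
    (hD : Integrable (rightRLDeriv ⊤ (β + 2) v))
    (hF : Integrable (𝓕 fun x : ℝ => (rightRLDeriv ⊤ (β + 2) v x : ℂ))) :
    ∃ C, ∀ h, 0 < h → ∀ x : ℝ,
      |1 / h ^ β * ∑' k : ℕ, w β k * v (x + (k - 1) * h) - rightRLDeriv ⊤ β v x| ≤ C * h ^ 2 := by
  have hDeq := funext (leftRLDeriv_comp_neg (β + 2) v)
  obtain ⟨C, hC⟩ := exists_truncation_left_le (a := -b) (v := fun y => v (-y)) hβ hβ'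
    (by fun_prop) hvi.comp_neg (fun x hx => h0 _ (by linarith)) (fun n hn x _ => by
      rw [funext (iteratedDeriv_leftRLIntegral_comp_neg n _ v)]
      exact ((hd n hn (-x) (mem_univ _)).comp x differentiableAt_id.neg).const_mul _)
    (by rw [hDeq]; exact hD.comp_neg) (by
      have h1 : 𝓕 (fun x : ℝ => (leftRLDeriv ⊥ (β + 2) (fun y => v (-y)) x : ℂ))
          = fun ω => 𝓕 (fun x : ℝ => (rightRLDeriv ⊤ (β + 2) v x : ℂ)) (-ω) := by
        rw [hDeq]
        ext ω
        rw [← Real.fourierInv_eq_fourier_neg, Real.fourierInv_eq_fourier_comp_neg]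
      rw [h1]
      exact hF.comp_neg)
  refine ⟨C, fun h hh x => ?_⟩
  have := hC h hh (-x)
  rw [leftRLDeriv_comp_neg, neg_neg] at this
  convert this using 8
  ring

end WSGD

/-! ### From the interval to the line, and convergence -/

namespace WSGD

open Filter Topology

lemma continuous_indicator_Icc {a b : ℝ} {u : ℝ → ℝ} (hu : ContinuousOn u (Icc a b))
    (ha : u a = 0) (hb : u b = 0) : Continuous (indicator (Icc a b) u) := by
  rcases lt_or_ge b a with h | h
  · rw [Icc_eq_empty (not_le.2 h), indicator_empty]; exact continuous_const
  refine continuous_indicator (fun x hx => ?_) (by rwa [closure_Icc])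
  rw [frontier_Icc h] at hx
  rcases hx with rfl | rfl
  exacts [ha, hb]

lemma leftRLIntegral_indicator {a b : ℝ} (u : ℝ → ℝ) (μ : ℝ) {x : ℝ} (hx : x ∈ Ioo a b) :
    leftRLIntegral a μ u x = leftRLIntegral ⊥ μ (indicator (Icc a b) u) x := by
  rw [leftRLIntegral, leftRLIntegral]
  split_ifs
  · rw [indicator_of_mem (Ioo_subset_Icc_self hx)]
  congr 1
  have h1 : {ζ : ℝ | (⊥ : EReal) < (ζ : EReal) ∧ ζ < x} = Iio x := by ext ζ; simp
  have h2 : {ζ : ℝ | (a : EReal) < (ζ : EReal) ∧ ζ < x} = Ioo a x := by ext ζ; simp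
  have h3 : ∀ ζ, indicator (Icc a b) u ζ / (x - ζ) ^ (1 - μ)
      = indicator (Icc a b) (fun ζ => u ζ / (x - ζ) ^ (1 - μ)) ζ := fun ζ => by
    by_cases h : ζ ∈ Icc a b <;> simp [h]
  have h4 : Iio x ∩ Icc a b = Ico a x := by
    ext ζ
    simp only [mem_inter_iff, mem_Iio, mem_Icc, mem_Ico]
    constructor
    · exact fun h => ⟨h.2.1, h.1⟩
    · exact fun h => ⟨h.2, h.1, (h.2.trans hx.2).le⟩
  simp_rw [h3]
  rw [h1, h2, setIntegral_indicator measurableSet_Icc, h4, integral_Ico_eq_integral_Ioo]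

lemma rightRLIntegral_indicator {a b : ℝ} (u : ℝ → ℝ) (μ : ℝ) {x : ℝ} (hx : x ∈ Ioo a b) :
    rightRLIntegral b μ u x = rightRLIntegral ⊤ μ (indicator (Icc a b) u) x := by
  rw [rightRLIntegral, rightRLIntegral]
  split_ifs
  · rw [indicator_of_mem (Ioo_subset_Icc_self hx)]
  congr 1
  have h1 : {ζ : ℝ | x < ζ ∧ (ζ : EReal) < ⊤} = Ioi x := by ext ζ; simp
  have h2 : {ζ : ℝ | x < ζ ∧ (ζ : EReal) < (b : EReal)} = Ioo x b := by ext ζ; simp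
  have h3 : ∀ ζ, indicator (Icc a b) u ζ / (ζ - x) ^ (1 - μ)
      = indicator (Icc a b) (fun ζ => u ζ / (ζ - x) ^ (1 - μ)) ζ := fun ζ => by
    by_cases h : ζ ∈ Icc a b <;> simp [h]
  have h4 : Ioi x ∩ Icc a b = Ioc x b := by
    ext ζ
    simp only [mem_inter_iff, mem_Ioi, mem_Icc, mem_Ioc]
    constructor
    · exact fun h => ⟨h.1, h.2.2⟩
    · exact fun h => ⟨h.1, (hx.1.trans h.1).le, h.2⟩
  simp_rw [h3]
  rw [h1, h2, setIntegral_indicator measurableSet_Icc, h4, integral_Ioc_eq_integral_Ioo]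

/-- The two integrals agree on the open interval, hence near `x`, which is enough for their
derivatives. -/
lemma leftRLDeriv_indicator {a b : ℝ} (u : ℝ → ℝ) (σ : ℝ) {x : ℝ} (hx : x ∈ Ioo a b) :
    leftRLDeriv a σ u x = leftRLDeriv ⊥ σ (indicator (Icc a b) u) x := by
  refine EventuallyEq.iteratedDeriv_eq _ ?_
  filter_upwards [isOpen_Ioo.mem_nhds hx] with y hy using leftRLIntegral_indicator u _ hy

lemma rightRLDeriv_indicator {a b : ℝ} (u : ℝ → ℝ) (σ : ℝ) {x : ℝ} (hx : x ∈ Ioo a b) :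
    rightRLDeriv b σ u x = rightRLDeriv ⊤ σ (indicator (Icc a b) u) x := by
  rw [rightRLDeriv, rightRLDeriv]
  congr 1
  refine EventuallyEq.iteratedDeriv_eq _ ?_
  filter_upwards [isOpen_Ioo.mem_nhds hx] with y hy using rightRLIntegral_indicator u _ hy

lemma step_pos {a b : ℝ} (hab : a < b) {M : ℕ} (hM : 1 ≤ M) : 0 < step a b M := by
  have : (0 : ℝ) < M := by exact_mod_cast hM
  exact div_pos (by linarith) this

lemma node_last (a b : ℝ) {M : ℕ} (hM : 1 ≤ M) : node a b M M = b := by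
  have : (M : ℝ) ≠ 0 := by positivity
  rw [node, step]; field_simp; ring

lemma node_lt_node {a b : ℝ} (hab : a < b) {M : ℕ} (hM : 1 ≤ M) {i j : ℕ} (hij : i < j) :
    node a b M i < node a b M j := by
  have := step_pos hab hM
  rw [node, node]
  gcongr

lemma node_mem_Icc {a b : ℝ} (hab : a < b) {M : ℕ} (hM : 1 ≤ M) {j : ℕ} (hj : j ≤ M) :
    node a b M j ∈ Icc a b := by
  have h := step_pos hab hM
  refine ⟨?_, ?_⟩
  · rw [node]; have : 0 ≤ (j : ℝ) * step a b M := by positivity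
    linarith
  · refine le_of_le_of_eq ?_ (node_last a b hM)
    rw [node, node]
    gcongr

lemma node_mem_Ioo {a b : ℝ} (hab : a < b) {M : ℕ} (hM : 1 ≤ M) {j : ℕ} (hj : 1 ≤ j)
    (hj' : j < M) : node a b M j ∈ Ioo a b := by
  refine ⟨?_, ?_⟩
  · simpa [node] using node_lt_node hab hM hj
  · simpa [node_last a b hM] using node_lt_node hab hM hj'

/-- Terms with `k > j` sample the extension at or to the left of `a`; the first of them falls
exactly on `a`, where `u` vanishes. -/
lemma deltaLeft_node_eq_tsum {a b β : ℝ} (hab : a < b) {u : ℝ → ℝ} (ha : u a = 0) {M : ℕ}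
    (hM : 1 ≤ M) {j : ℕ} (hj' : j < M) :
    deltaLeft β (step a b M) (fun i => u (node a b M i)) j = 1 / step a b M ^ β *
      ∑' k : ℕ, w β k * indicator (Icc a b) u (node a b M j - (k - 1) * step a b M) := by
  have hpos := step_pos hab hM
  rw [deltaLeft, tsum_eq_sum (s := Finset.range (j + 1))]
  · congr 1
    refine Finset.sum_congr rfl fun k hk => ?_
    have hk := Finset.mem_range.1 hk
    have : node a b M j - (k - 1) * step a b M = node a b M (j + 1 - k) := by
      rw [node, node, Nat.cast_sub hk.le]; push_cast; ring
    rw [this, indicator_of_mem (node_mem_Icc hab hM (by omega))]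
  · intro k hk
    have hk : j + 1 ≤ k := by simpa using hk
    have hk' : (j : ℝ) + 1 ≤ k := by exact_mod_cast hk
    have hx : node a b M j - (k - 1) * step a b M ≤ a := by rw [node]; nlinarith
    rcases hx.eq_or_lt with h | h
    · rw [h, indicator_apply, ha, ite_self, mul_zero]
    · rw [indicator_of_notMem (fun hm => absurd hm.1 (not_le.2 h)), mul_zero]

lemma deltaRight_node_eq_tsum {a b β : ℝ} (hab : a < b) {u : ℝ → ℝ} (hb : u b = 0) {M : ℕ}
    (hM : 1 ≤ M) {j : ℕ} (hj : 1 ≤ j) (hj' : j < M) :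
    deltaRight β (step a b M) M (fun i => u (node a b M i)) j = 1 / step a b M ^ β *
      ∑' k : ℕ, w β k * indicator (Icc a b) u (node a b M j + (k - 1) * step a b M) := by
  have hpos := step_pos hab hM
  rw [deltaRight, tsum_eq_sum (s := Finset.range (M - j + 1))]
  · congr 1
    refine Finset.sum_congr rfl fun k hk => ?_
    have hk := Finset.mem_range.1 hk
    have : node a b M j + (k - 1) * step a b M = node a b M (j + k - 1) := by
      rw [node, node, Nat.cast_sub (by omega)]; push_cast; ring
    rw [this, indicator_of_mem (node_mem_Icc hab hM (by omega))]
  · intro k hk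
    have hk : M - j + 1 ≤ k := by simpa using hk
    have hk' : (M : ℝ) + 1 ≤ j + k := by exact_mod_cast (by omega : M + 1 ≤ j + k)
    have hx : b ≤ node a b M j + (k - 1) * step a b M := by
      refine (node_last a b hM).symm.trans_le ?_
      rw [node, node]
      nlinarith
    rcases hx.eq_or_lt with h | h
    · rw [← h, indicator_apply, hb, ite_self, mul_zero]
    · rw [indicator_of_notMem (fun hm => absurd hm.2 (not_le.2 h)), mul_zero]

/-- The error solves the scheme with the truncation error as right-hand side, since `f` cancels at
the nodes; stability then transfers the `h²` bound. -/
theorem scheme_convergence {a b α β θ : ℝ} (hab : a < b) (hα : 0 ≤ α)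
    (hβ : 1 < β) (hβ' : β ≤ 2) {f u : ℝ → ℝ} (hu : IsBVPSolution a b α β θ f u)
    {C₁ C₂ : ℝ}
    (hL : ∀ h, 0 < h → ∀ x : ℝ, |1 / h ^ β * ∑' k : ℕ, w β k *
      indicator (Icc a b) u (x - (k - 1) * h) - leftRLDeriv ⊥ β (indicator (Icc a b) u) x|
        ≤ C₁ * h ^ 2)
    (hR : ∀ h, 0 < h → ∀ x : ℝ, |1 / h ^ β * ∑' k : ℕ, w β k *
      indicator (Icc a b) u (x + (k - 1) * h) - rightRLDeriv ⊤ β (indicator (Icc a b) u) x|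
        ≤ C₂ * h ^ 2) :
    ∃ c : ℝ, ∀ M : ℕ, 1 ≤ M → ∀ U : ℕ → ℝ, IsSchemeSolution a b α β θ f M U →
      ∀ j : ℕ, 1 ≤ j → j < M → |u (node a b M j) - U j| ≤ c * step a b M ^ 2 := by
  obtain ⟨C, hC⟩ := scheme_stability' (θ := θ) hab hα hβ hβ'
  refine ⟨C * (|θ| * C₁ + |1 - θ| * C₂), fun M hM U hU j hj hj' => ?_⟩
  have hpos := step_pos hab hM
  have hC₁ : 0 ≤ C₁ * step a b M ^ 2 := (abs_nonneg _).trans (hL _ hpos 0)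
  have hC₂ : 0 ≤ C₂ * step a b M ^ 2 := (abs_nonneg _).trans (hR _ hpos 0)
  have key := hC M hM (fun i => u (node a b M i) + (-1) * U i)
    (by simp [node, hu.left_boundary, hU.left_boundary])
    (by simp [node_last a b hM, hu.right_boundary, hU.right_boundary])
    (|θ| * (C₁ * step a b M ^ 2) + |1 - θ| * (C₂ * step a b M ^ 2)) (by positivity)
    (fun i hi hi' => ?_) j hj'.le
  · refine (le_of_eq ?_).trans (key.trans_eq (by ring))
    congr 1; ring
  · rw [deltaLeft_add_smul, deltaRight_add_smul]
    have hmem := node_mem_Ioo hab hM hi hi'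
    have h1 := hU.equation i hi hi'
    have h2 := hu.equation _ hmem
    have h3 := hL _ hpos (node a b M i)
    have h4 := hR _ hpos (node a b M i)
    rw [← deltaLeft_node_eq_tsum hab hu.left_boundary hM hi', ← leftRLDeriv_indicator u β hmem] at h3
    rw [← deltaRight_node_eq_tsum hab hu.right_boundary hM hi hi',
      ← rightRLDeriv_indicator u β hmem] at h4
    set A := deltaLeft β (step a b M) (fun i => u (node a b M i)) i
    set B := deltaRight β (step a b M) M (fun i => u (node a b M i)) i
    have h5 : α * (u (node a b M i) + -1 * U i) - θ * (A + -1 * deltaLeft β (step a b M) U i)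
        - (1 - θ) * (B + -1 * deltaRight β (step a b M) M U i)
        = -(θ * (A - leftRLDeriv a β u (node a b M i))
          + (1 - θ) * (B - rightRLDeriv b β u (node a b M i))) := by
      linear_combination h2 - h1
    rw [h5, abs_neg]
    refine (abs_add_le _ _).trans ?_
    rw [abs_mul, abs_mul]
    gcongr

end WSGD

end

theorem mainTheorem1 (a b α β θ : ℝ) (hab : a < b) (hα : 0 < α)
    (hβ : 1 < β) (hβ' : β ≤ 2) (hθ : 0 ≤ θ) (hθ' : θ ≤ 1) :
    -- unique solvability, for every mesh and every right-hand side
    (∀ (f : ℝ → ℝ) (M : ℕ), 1 ≤ M →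
      ∃ U : ℕ → ℝ, WSGD.IsSchemeSolution a b α β θ f M U ∧
        ∀ V : ℕ → ℝ, WSGD.IsSchemeSolution a b α β θ f M V → ∀ j ≤ M, V j = U j) ∧
    -- second-order convergence in the maximum norm
    (∀ f u : ℝ → ℝ, WSGD.IsBVPSolution a b α β θ f u →
      Integrable (indicator (Icc a b) u) →
      WSGD.LeftRLDifferentiableOn ⊥ (β + 2) (indicator (Icc a b) u) univ →
      WSGD.RightRLDifferentiableOn ⊤ (β + 2) (indicator (Icc a b) u) univ →
      Integrable (WSGD.leftRLDeriv ⊥ (β + 2) (indicator (Icc a b) u)) →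
      Integrable (WSGD.rightRLDeriv ⊤ (β + 2) (indicator (Icc a b) u)) →
      Integrable (𝓕 (fun x : ℝ =>
        (WSGD.leftRLDeriv ⊥ (β + 2) (indicator (Icc a b) u) x : ℂ))) →
      Integrable (𝓕 (fun x : ℝ =>
        (WSGD.rightRLDeriv ⊤ (β + 2) (indicator (Icc a b) u) x : ℂ))) →
      ∃ c : ℝ, ∀ M : ℕ, 1 ≤ M → ∀ U : ℕ → ℝ, WSGD.IsSchemeSolution a b α β θ f M U →
        ∀ j : ℕ, 1 ≤ j → j < M →
          |u (WSGD.node a b M j) - U j| ≤ c * WSGD.step a b M ^ 2) := by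
  refine ⟨fun f M hM => WSGD.scheme_existsUnique hab hα.le hβ hβ' f hM,
    fun f u hu hint hdL hdR hL hR hFL hFR => ?_⟩
  have hc := WSGD.continuous_indicator_Icc hu.continuousOn hu.left_boundary hu.right_boundary
  obtain ⟨C₁, h₁⟩ := WSGD.exists_truncation_left_le hβ hβ' hc hint
    (fun x hx => indicator_of_notMem (fun hm => absurd hm.1 (not_le.2 hx)) u) hdL hL hFL
  obtain ⟨C₂, h₂⟩ := WSGD.exists_truncation_right_le hβ hβ' hc hint
    (fun x hx => indicator_of_notMem (fun hm => absurd hm.2 (not_le.2 hx)) u) hdR hR hFR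
  exact WSGD.scheme_convergence hab hα.le hβ hβ' hu h₁ h₂
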